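/- Let $\Bbbk$ be a field. A *presentation* $(\bm m,\simeq)$ consists of integers $m_1,\dots,m_s\ge 2$ and a symmetric relation $\simeq$ on $O=\{(i,j)\mid 1\le i\le s,\ 1\le j\le m_i\}$ which relates each pair to at most one pair, different from it. Let $T_m$ be the algebra of lower triangular $m\times m$ matrices over $\Bbbk$, $H_i=T_{m_i}$ and $H=H_1\times\cdots\times H_s$. The *gentle algebra* of $(\bm m,\simeq)$ is the subalgebra $$A(\bm m,\simeq)=\{X\in H \mid X(i)_{jj}=X(k)_{ll}\text{ whenever }(i,j)\simeq(k,l)\},$$ and its *Burban–Drozd algebra* is the algebra of $2\times2$ matrices over $H$ $$\mathrm{BD}(A)=\begin{pmatrix}A&H\\ \mathrm{rad}\,A&H\end{pmatrix}.$$ *Marked surfaces.* For $m\ge1$ let $P_m$ be the closed $(m+1)$-gon (a closed disc with $m+1$ vertices on its boundary circle), oriented, one edge of which is its boundary edge, carrying one open marked point in its interior; the other edges, numbered $1,\dots,m$ anticlockwise from the boundary edge, are its closed arcs, and the vertices are its closed marked points. Edges are always glued so that the orientations agree. The *marked surface* $\mathbf S_{(\bm m,\simeq)}$ is obtained from $P_{m_1},\dots,P_{m_s}$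 and one $2$-gon $P_1$ for each $(i,j)\in O$ that is related to no pair, by gluing the $j$-th arc of $P_{m_i}$ to the $l$-th arc of $P_{m_k}$ whenever $(i,j)\simeq(k,l)$, and the $j$-th arc of $P_{m_i}$ to the arc of the $2$-gon of $(i,j)$ if $(i,j)$ is related to no pair. It carries the images of the marked points, of the closed arcs and of the oriented boundary edges. Two marked surfaces are *homotopic* if there is an orientation-preserving homeomorphism between them that carries closed marked points, open marked points, the system of closed arcs and the boundary edges of one to those of the other. If an algebra $B$ is isomorphic to $A(\bm m',\simeq')$, then $\mathbf S_{(\bm m',\simeq')}$ is called a marked surface of $B$; if a marked surface $\mathbf S$ is homotopic to $\mathbf S_{(\bm m',\simeq')}$, then $A(\bm m',\simeq')$ is called a gentle algebra of $\mathbf S$. *The surface $\mathrm{BD}(\mathbf S)$.* Let $\mathbf S=\mathbf S_{(\bm m,\simeq)}$. For each $i$ take the marked surface $\mathbf S_{\mathrm{BD}(H_i)}$ of $\mathrm{BD}(H_i)\cong T_{2m_i}$, i.e. $P_{2m_i}$ with a $2$-gon glued to each of its arcs; the arcs of $P_{2m_i}$ are labelled $(i,1)',(i,1),(i,2)',(i,2),\dots,(i,m_i)',(i,m_i)$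 in the order $1,\dots,2m_i$. For each $j$ such that $(i,j)$ is related to some pair, remove the $2$-gon glued to the arc labelled $(i,j)$ (keeping the arc); this gives the incomplete surface $\mathbf S^{\mathrm{inc}}_{\mathrm{BD}(H_i)}$. Then $\mathrm{BD}(\mathbf S)$ is obtained from the disjoint union of the incomplete surfaces by gluing the arcs labelled $(i,j)$ and $(k,l)$ for all $(i,j)\simeq(k,l)$. **Proposition.** Let $(\bm m,\simeq)$ be a presentation, $A=A(\bm m,\simeq)$ and $\mathbf S=\mathbf S_{(\bm m,\simeq)}$. 1. $\mathrm{BD}(A)$ has a marked surface (that is, $\mathrm{BD}(A)\cong A(\bm m',\simeq')$ for some presentation), and every marked surface of $\mathrm{BD}(A)$ is homotopic to $\mathrm{BD}(\mathbf S)$. 2. $\mathrm{BD}(\mathbf S)$ has a gentle algebra (that is, $\mathrm{BD}(\mathbf S)$ is homotopic to $\mathbf S_{(\bm m',\simeq')}$ for some presentation), and every gentle algebra of $\mathrm{BD}(\mathbf S)$ is isomorphic to $\mathrm{BD}(A)$ as a $\Bbbk$-algebra. -/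

import Mathlib

open scoped unitInterval

/-! ## Combinatorial presentations of gentle algebras and of marked surfaces -/

/-- A presentation `(𝐦, ≃)`: a tuple `𝐦 = (m₁, …, m_s)` of integers `≥ 2` together with a symmetric
relation on the set of all pairs `(i, j)` (`j` an index of the `i`-th block) relating each pair to
at most one pair, distinct from it. Indices start at `0`. -/
structure GentleDatum where
  s : ℕ
  m : Fin s → ℕ
  two_le : ∀ i, 2 ≤ m i
  rel : (Σ i : Fin s, Fin (m i)) → (Σ i : Fin s, Fin (m i)) → Prop
  symm : ∀ {a b}, rel a b → rel b a
  irrefl : ∀ a, ¬ rel a a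
  unique : ∀ {a b c}, rel a b → rel a c → b = c

namespace GentleDatum

/-- The set of all pairs `(i, j)`. -/
abbrev O (d : GentleDatum) : Type := Σ i : Fin d.s, Fin (d.m i)

/-- The pair `a` is related to some (other) pair. -/
def Glued (d : GentleDatum) (a : d.O) : Prop := ∃ b, d.rel a b

/-- The presentation with one block, of size `n`, and the empty relation; its algebra is the
algebra of all lower triangular `n × n` matrices. -/
def single (n : ℕ) (hn : 2 ≤ n) : GentleDatum where
  s := 1
  m _ := n
  two_le _ := hn
  rel _ _ := False
  symm h := h
  irrefl _ h := h
  unique h := h.elim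

/-! ## The algebras -/

section Algebras

theorem map_eq_zero_of_mem_jacobson {R K : Type*} [Ring R] [Field K] (φ : R →+* K)
    (hφ : Function.Surjective φ) {r : R} (hr : r ∈ Ring.jacobson R) : φ r = 0 := by
  have : RingHomSurjective φ := ⟨hφ⟩
  have h : r ∈ Ideal.comap φ (Ring.jacobson K) := Ring.le_comap_jacobson φ hr
  rw [IsSemisimpleRing.jacobson_eq_bot] at h
  simpa using h

theorem mem_jacobson_of_nilpotent {R : Type*} [Ring R] {r : R}
    (hr : ∀ y : R, ∃ n : ℕ, (y * r) ^ n = 0) : r ∈ Ring.jacobson R := by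
  rw [← Ideal.jacobson_bot, Ideal.mem_jacobson_iff]
  intro y
  have hnil : IsNilpotent (y * r) := hr y
  obtain ⟨z, hz⟩ := hnil.isUnit_add_one
  refine ⟨((z⁻¹ : Rˣ) : R), ?_⟩
  have h : ((z⁻¹ : Rˣ) : R) * (y * r + 1) = 1 := by
    rw [← hz]; exact z.inv_mul
  rw [mul_add, mul_one, ← mul_assoc] at h
  rw [h, sub_self]
  exact Submodule.zero_mem _

variable (k : Type*) [Field k] (d : GentleDatum)

/-- `H = H₁ × ⋯ × H_s`, where `H_i` is the algebra of lower triangular `m_i × m_i` matrices. -/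
def normalization : Subalgebra k (∀ i : Fin d.s, Matrix (Fin (d.m i)) (Fin (d.m i)) k) where
  carrier := {X | ∀ i u v, u < v → X i u v = 0}
  mul_mem' := by
    intro X Y hX hY i u v huv
    simp only [Pi.mul_apply, Matrix.mul_apply]
    refine Finset.sum_eq_zero fun w _ => ?_
    rcases lt_or_ge u w with h | h
    · rw [hX i u w h, zero_mul]
    · rw [hY i w v (lt_of_le_of_lt h huv), mul_zero]
  add_mem' := by
    intro X Y hX hY i u v huv
    simp [hX i u v huv, hY i u v huv]
  algebraMap_mem' := by
    intro r i u v huv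
    simp [Matrix.algebraMap_matrix_apply, huv.ne]

variable {k d} in
theorem normalization_mul_diag (X Y : d.normalization k) (i : Fin d.s) (u : Fin (d.m i)) :
    (X * Y).1 i u u = X.1 i u u * Y.1 i u u := by
  change (∑ w, X.1 i u w * Y.1 i w u) = _
  refine Finset.sum_eq_single u (fun w _ hw => ?_) (by simp)
  rcases lt_or_gt_of_ne hw with h | h
  · rw [Y.2 i w u h, mul_zero]
  · rw [X.2 i u w h, zero_mul]

/-- The gentle algebra `A(𝐦, ≃)`: the subalgebra of `H` of all tuples of lower triangular matrices
whose `(j, j)` entry in block `i` equals the `(l, l)` entry in block `k` if `(i, j) ≃ (k, l)`. -/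
def algebra : Subalgebra k (d.normalization k) where
  carrier := {X | ∀ a b, d.rel a b → X.1 a.1 a.2 a.2 = X.1 b.1 b.2 b.2}
  mul_mem' := by
    intro X Y hX hY a b h
    rw [normalization_mul_diag, normalization_mul_diag, hX a b h, hY a b h]
  add_mem' := by
    intro X Y hX hY a b h
    change X.1 a.1 a.2 a.2 + Y.1 a.1 a.2 a.2 = X.1 b.1 b.2 b.2 + Y.1 b.1 b.2 b.2
    rw [hX a b h, hY a b h]
  algebraMap_mem' := by
    intro r a b _
    change (algebraMap k (Matrix _ _ k) r) a.2 a.2 = (algebraMap k (Matrix _ _ k) r) b.2 b.2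
    simp [Matrix.algebraMap_matrix_apply]

variable {k d}

/-- The Jacobson radical of `A(𝐦, ≃)` consists of the strictly lower triangular tuples. -/
theorem mem_jacobson_algebra (r : d.algebra k) :
    r ∈ Ring.jacobson (d.algebra k) ↔ ∀ i u, r.1.1 i u u = 0 := by
  constructor
  · intro hr i u
    let φ : d.algebra k →+* k :=
      { toFun := fun X => X.1.1 i u u
        map_one' := by
          change (1 : Matrix (Fin (d.m i)) (Fin (d.m i)) k) u u = 1
          simp
        map_zero' := rfl
        map_add' := fun _ _ => rfl
        map_mul' := fun X Y => normalization_mul_diag X.1 Y.1 i u }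
    have hφ : Function.Surjective φ := fun c => by
      refine ⟨algebraMap k _ c, ?_⟩
      change (algebraMap k (Matrix (Fin (d.m i)) (Fin (d.m i)) k) c) u u = c
      simp [Matrix.algebraMap_matrix_apply]
    exact map_eq_zero_of_mem_jacobson φ hφ hr
  · intro hr
    refine mem_jacobson_of_nilpotent fun y => ⟨∑ i, d.m i, ?_⟩
    have hd : ∀ i u, (y * r).1.1 i u u = 0 := fun i u => by
      have := normalization_mul_diag y.1 r.1 i u
      rw [hr i u, mul_zero] at this
      exact this
    have hpow : ∀ n : ℕ, ∀ (i : Fin d.s) (u v : Fin (d.m i)), u.1 < v.1 + n →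
        ((y * r) ^ n).1.1 i u v = 0 := by
      intro n
      induction n with
      | zero =>
        intro i u v huv
        exact ((y * r) ^ 0).1.2 i u v (Fin.lt_def.2 (by simpa using huv))
      | succ n ih =>
        intro i u v huv
        rw [pow_succ]
        change (∑ w, ((y * r) ^ n).1.1 i u w * (y * r).1.1 i w v) = 0
        refine Finset.sum_eq_zero fun w _ => ?_
        by_cases hw : w ≤ v
        · rcases hw.lt_or_eq with h | h
          · rw [(y * r).1.2 i w v h, mul_zero]
          · rw [h, hd, mul_zero]
        · have hw' : v.1 < w.1 := Fin.lt_def.1 (not_le.1 hw)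
          rw [ih i u w (by omega), zero_mul]
    apply Subtype.ext
    apply Subtype.ext
    funext i
    ext u v
    refine hpow _ i u v ?_
    have h1 : d.m i ≤ ∑ i, d.m i :=
      Finset.single_le_sum (f := d.m) (fun _ _ => Nat.zero_le _) (Finset.mem_univ i)
    have h2 := u.2
    omega

variable (k d)

/-- `rad A`, as a subset of `H`. -/
def rad : Set (d.normalization k) := {x | ∃ r ∈ Ring.jacobson (d.algebra k), r.1 = x}

variable {k d}

theorem mem_rad (x : d.normalization k) : x ∈ d.rad k ↔ ∀ i u, x.1 i u u = 0 := by
  constructor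
  · rintro ⟨r, hr, rfl⟩
    exact (mem_jacobson_algebra r).1 hr
  · intro h
    refine ⟨⟨x, fun a b _ => by rw [h, h]⟩, (mem_jacobson_algebra _).2 h, rfl⟩

theorem rad_le_algebra {x : d.normalization k} (hx : x ∈ d.rad k) : x ∈ d.algebra k := by
  obtain ⟨r, _, rfl⟩ := hx
  exact r.2

theorem rad_add {x y : d.normalization k} (hx : x ∈ d.rad k) (hy : y ∈ d.rad k) :
    x + y ∈ d.rad k := by
  rw [mem_rad] at *
  intro i u
  change x.1 i u u + y.1 i u u = 0
  rw [hx, hy, add_zero]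

theorem rad_mul_left (x : d.normalization k) {y : d.normalization k} (hy : y ∈ d.rad k) :
    x * y ∈ d.rad k := by
  rw [mem_rad] at *
  intro i u
  rw [normalization_mul_diag, hy, mul_zero]

theorem rad_mul_right {x : d.normalization k} (hx : x ∈ d.rad k) (y : d.normalization k) :
    x * y ∈ d.rad k := by
  rw [mem_rad] at *
  intro i u
  rw [normalization_mul_diag, hx, zero_mul]

variable (k d)

/-- The Burban–Drozd algebra `BD(A)`: all `2 × 2` matrices over `H` whose first column lies in
`A × rad A`, with the matrix multiplication. -/
def BDAlgebra : Subalgebra k (Matrix (Fin 2) (Fin 2) (d.normalization k)) where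
  carrier := {M | M 0 0 ∈ d.algebra k ∧ M 1 0 ∈ d.rad k}
  mul_mem' := by
    rintro M N ⟨hM, hM'⟩ ⟨hN, hN'⟩
    constructor
    · rw [Matrix.mul_apply, Fin.sum_univ_two]
      exact add_mem (mul_mem hM hN) (rad_le_algebra (rad_mul_left _ hN'))
    · rw [Matrix.mul_apply, Fin.sum_univ_two]
      exact rad_add (rad_mul_right hM' _) (rad_mul_left _ hN')
  add_mem' := by
    rintro M N ⟨hM, hM'⟩ ⟨hN, hN'⟩
    exact ⟨add_mem hM hN, rad_add hM' hN'⟩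
  algebraMap_mem' := by
    intro r
    constructor
    · simp [Matrix.algebraMap_matrix_apply]
    · rw [mem_rad]
      intro i u
      simp [Matrix.algebraMap_matrix_apply]

end Algebras

end GentleDatum

/-! ## Marked surfaces -/

/-- A topological space with closed marked points, open marked points, a set of closed arcs (as
subsets), and the set of boundary edges, parametrized by the unit interval in the direction given
by the orientation of the surface. The surfaces of the theory are built from polygons below. -/
structure MarkedSurface where
  carrier : Type
  [top : TopologicalSpace carrier]
  closedPts : Set carrier
  openPts : Set carrier
  arcs : Set (Set carrier)
  boundary : Set (I → carrier)

namespace MarkedSurface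

attribute [instance] MarkedSurface.top

/-- Two marked surfaces are homotopic if there is a homeomorphism between them which carries the
closed (open) marked points to the closed (open) marked points, the arc system to the arc system,
and the boundary edges to the boundary edges up to increasing reparametrization. (As every
component has a boundary edge, the last condition says that it preserves the orientation.) -/
def Homotopic (S T : MarkedSurface) : Prop :=
  ∃ f : S.carrier ≃ₜ T.carrier,
    f '' S.closedPts = T.closedPts ∧
    f '' S.openPts = T.openPts ∧
    (fun c : Set S.carrier => f '' c) '' S.arcs = T.arcs ∧
    (∀ γ ∈ S.boundary, ∃ θ : I ≃o I, f ∘ γ ∘ θ ∈ T.boundary) ∧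
    (∀ γ ∈ T.boundary, ∃ θ : I ≃o I, f.symm ∘ γ ∘ θ ∈ S.boundary)

/-- The closed unit disc. -/
abbrev Disc : Type := Metric.closedBall (0 : ℂ) 1

/-- The `j`-th edge of the `(m + 1)`-gon, drawn as a disc whose boundary circle is divided into
`m + 1` equal edges, numbered `0, 1, …, m` and run through anticlockwise. -/
noncomputable def edge (m j : ℕ) (t : I) : Disc :=
  ⟨Circle.exp (2 * Real.pi * (j + (t : ℝ)) / (m + 1)), by
    rw [mem_closedBall_zero_iff]; exact (Circle.norm_coe _).le⟩

/-- The midpoint of the unit interval. -/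
noncomputable def half : I := ⟨1 / 2, by norm_num, by norm_num⟩

/-- The polygon of the algebra of lower triangular `m × m` matrices: an `(m + 1)`-gon with one
boundary edge (number `0`) that carries an open marked point; the other edges, numbered `1, …, m`
in anticlockwise order, are the closed arcs, and the vertices are the closed marked points. -/
noncomputable def polygon (m : ℕ) : MarkedSurface where
  carrier := Disc
  closedPts := {p | ∃ j, j ≤ m ∧ p = edge m j 0}
  openPts := {edge m 0 half}
  arcs := {c | ∃ j, 1 ≤ j ∧ j ≤ m ∧ c = Set.range (edge m j)}
  boundary := {edge m 0}

/-- Disjoint union. -/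
def disjointUnion {ι : Type} (S : ι → MarkedSurface) : MarkedSurface where
  carrier := Σ i, (S i).carrier
  closedPts := {p | p.2 ∈ (S p.1).closedPts}
  openPts := {p | p.2 ∈ (S p.1).openPts}
  arcs := {c | ∃ i, ∃ c' ∈ (S i).arcs, c = Sigma.mk i '' c'}
  boundary := {γ | ∃ i, ∃ γ' ∈ (S i).boundary, γ = Sigma.mk i ∘ γ'}

/-- The quotient by the equivalence relation generated by `r`. -/
def glue (S : MarkedSurface) (r : S.carrier → S.carrier → Prop) : MarkedSurface where
  carrier := Quot r
  closedPts := Quot.mk r '' S.closedPts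
  openPts := Quot.mk r '' S.openPts
  arcs := (fun c => Quot.mk r '' c) '' S.arcs
  boundary := (fun γ => Quot.mk r ∘ γ) '' S.boundary

/-- The part of a marked surface lying in a subset `Y`. -/
def restrict (S : MarkedSurface) (Y : Set S.carrier) : MarkedSurface where
  carrier := Y
  closedPts := {p | p.1 ∈ S.closedPts}
  openPts := {p | p.1 ∈ S.openPts}
  arcs := {c | Subtype.val '' c ∈ S.arcs}
  boundary := {γ | Subtype.val ∘ γ ∈ S.boundary}

end MarkedSurface

namespace GentleDatum

open MarkedSurface

variable (d : GentleDatum)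

/-- The polygons from which the marked surface is glued: one for each block, and a `2`-gon for each
pair `(i, j)` that is related to no other pair. -/
abbrev PolyIdx : Type := Fin d.s ⊕ {a : d.O // ¬ d.Glued a}

/-- The number of closed arcs of a polygon. -/
def polySize : d.PolyIdx → ℕ := Sum.elim d.m fun _ => 1

/-- The disjoint union of the polygons. -/
noncomputable def polygons : MarkedSurface := disjointUnion fun p => polygon (d.polySize p)

/-- The point with parameter `t` of the `j`-th edge of the polygon `p`. -/
noncomputable def edgePt (p : d.PolyIdx) (j : ℕ) (t : I) : d.polygons.carrier :=
  ⟨p, edge (d.polySize p) j t⟩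

/-- The pair `(i, j)` is represented by the closed arc number `j + 1` (as `j` starts at `0`) of the
`i`-th polygon. The arcs of related pairs are glued, and the arc of a pair that is related to no
pair is glued to the arc of its `2`-gon. Edges are glued so that the orientations of the polygons
agree. -/
inductive Glue : d.polygons.carrier → d.polygons.carrier → Prop
  | inv (a b : d.O) (h : d.rel a b) (t : I) :
      Glue (d.edgePt (.inl a.1) (a.2 + 1) t) (d.edgePt (.inl b.1) (b.2 + 1) (unitInterval.symm t))
  | bij (a : d.O) (h : ¬ d.Glued a) (t : I) :
      Glue (d.edgePt (.inr ⟨a, h⟩) 1 t) (d.edgePt (.inl a.1) (a.2 + 1) (unitInterval.symm t))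

/-- The marked surface of the gentle algebra `A(𝐦, ≃)`. -/
noncomputable def surface : MarkedSurface := d.polygons.glue d.Glue

/-- The projection from the polygons to the marked surface. -/
def proj (x : d.polygons.carrier) : d.surface.carrier := Quot.mk d.Glue x

/-! ## The construction of `BD(S)` -/

/-- The presentation of `BD(H_i) ≅ T_{2 m_i}`. Its indices `0, 1, …, 2 m_i - 1` stand for
`(i,1)', (i,1), (i,2)', (i,2), …, (i,m_i)', (i,m_i)`. -/
def double (i : Fin d.s) : GentleDatum := single (2 * d.m i) (by have := d.two_le i; omega)

/-- The position of `(i, j)` among the indices of `BD(H_i)`. -/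
def pos (a : d.O) : (d.double a.1).O :=
  ⟨(0 : Fin 1), (⟨2 * a.2.1 + 1, by have := a.2.2; omega⟩ : Fin (2 * d.m a.1))⟩

/-- The part of the marked surface of `BD(H_i)` that is left when the `2`-gons are removed which
have as an edge the arc of some pair `(i, j)` related to another pair; the arcs themselves stay. -/
def kept (i : Fin d.s) : Set (d.double i).surface.carrier :=
  (d.double i).proj '' {x | ∀ (j : Fin (d.m i)) h, d.Glued ⟨i, j⟩ →
    x.1 ≠ Sum.inr ⟨d.pos ⟨i, j⟩, h⟩}

/-- The incomplete surface of `BD(H_i)`. -/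
noncomputable def incomplete (i : Fin d.s) : MarkedSurface :=
  (d.double i).surface.restrict (d.kept i)

/-- The point with parameter `t` of the arc of `(i, j)` in the incomplete surface of `BD(H_i)`. -/
noncomputable def arcPt (a : d.O) (t : I) : (d.incomplete a.1).carrier :=
  (⟨(d.double a.1).proj ((d.double a.1).edgePt (.inl (0 : Fin 1)) ((d.pos a).2.1 + 1) t),
    Set.mem_image_of_mem _ (fun _ _ _ h => Sum.inl_ne_inr h)⟩ : d.kept a.1)

/-- The gluing of the arcs of `(i, j)` and `(k, l)` in the incomplete surfaces if
`(i, j) ≃ (k, l)`. -/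
inductive BDGlue : (disjointUnion d.incomplete).carrier → (disjointUnion d.incomplete).carrier → Prop
  | mk (a b : d.O) (h : d.rel a b) (t : I) :
      BDGlue ⟨a.1, d.arcPt a t⟩ ⟨b.1, d.arcPt b (unitInterval.symm t)⟩

/-- The marked surface `BD(S)`. -/
noncomputable def BDSurface : MarkedSurface := (disjointUnion d.incomplete).glue d.BDGlue

end GentleDatum

/-!
The theorem reduces to presentations. Let `d.bd` be the presentation with blocks twice as long in
which the pairs `(i, j)`, placed at the odd positions `2j + 1` (counting from `0`), are related as
in `d`, while the pairs `(i, j)'` at the even positions are related to no pair.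

* `nonempty_bd_algEquiv`: the algebra of `d.bd` is `BD(A)`. Ordering the rows and columns of the
  `2 × 2` matrices over `T_m` as `(i,1)', (i,1), (i,2)', …`, where `(i, j)` belongs to row and
  column `0` and `(i, j)'` to row and column `1`, turns them into lower triangular matrices.
* `bd_homotopic`: the surface of `d.bd` is `BD(S)`. Both are quotients of the same disjoint union of
  polygons by the same equivalence relation, because a removed `2`-gon only identifies points that
  are identified anyway.
* `eq_reindex_of_algEquiv`: the algebra determines the presentation up to a permutation of the
  blocks. The elements annihilated by the radical on both sides are spanned by the longest paths of
  the blocks, so that an isomorphism gives an invertible matrix between these paths. A nonzero term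
  of its determinant is a bijection of the blocks. It cannot shorten blocks, hence preserves their
  lengths, and then it is compatible with the characters of the algebra, which are the vertices.
* `eq_reindex_of_homotopic`: so does the surface. A homeomorphism that preserves the arcs lifts to
  the interiors of the polygons; the lift extends continuously to the polygons
  (`exists_continuous_lift`), because the projection to the surface is a closed map with finite
  fibres. Preserving the vertices, the arcs and the direction of the boundary edge, the lift moves
  along the arcs of a polygon monotonically and so preserves their numbers
  (`eq_and_exists_edge_eq`). Hence it also preserves the gluing.

Conversely a permutation of the blocks changes neither the algebra nor the surface up to isomorphism
(`nonempty_reindex_algEquiv`, `reindex_homotopic`).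
-/

namespace GentleDatum

/-! ### Permutations of the blocks -/

/-- The presentation obtained by permuting the blocks. -/
def reindex (d : GentleDatum) {s' : ℕ} (e : Fin s' ≃ Fin d.s) : GentleDatum where
  s := s'
  m i := d.m (e i)
  two_le i := d.two_le _
  rel a b := d.rel ⟨e a.1, a.2⟩ ⟨e b.1, b.2⟩
  symm h := d.symm h
  irrefl _ h := d.irrefl _ h
  unique {a b c} h h' := by
    obtain ⟨i, u⟩ := b
    obtain ⟨j, v⟩ := c
    have h := d.unique h h'
    rw [Sigma.mk.injEq] at h
    obtain ⟨h1, h2⟩ := h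
    obtain rfl := e.injective h1
    obtain rfl : u = v := eq_of_heq h2
    rfl

/-- A bijection of the blocks that respects their sizes and the relation. -/
theorem eq_reindex (d d' : GentleDatum) (e : Fin d'.s ≃ Fin d.s)
    (hm : ∀ i, d'.m i = d.m (e i))
    (hrel : ∀ a b, d'.rel a b ↔
      d.rel ⟨e a.1, Fin.cast (hm _) a.2⟩ ⟨e b.1, Fin.cast (hm _) b.2⟩) :
    d' = d.reindex e := by
  obtain ⟨s, m, h2, rel, h3, h4, h5⟩ := d'
  dsimp only at e hm
  obtain rfl : m = fun i => d.m (e i) := funext hm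
  obtain rfl : rel = fun a b => d.rel ⟨e a.1, a.2⟩ ⟨e b.1, b.2⟩ := by
    funext a b
    exact propext (hrel a b)
  rfl

section Algebras

variable (k : Type*) [Field k] (d : GentleDatum)

/-- Permuting the blocks does not change the gentle algebra. -/
theorem nonempty_reindex_algEquiv {s' : ℕ} (e : Fin s' ≃ Fin d.s) :
    Nonempty ((d.reindex e).algebra k ≃ₐ[k] d.algebra k) := by
  let f : d.algebra k →ₐ[k] (d.reindex e).algebra k :=
    { toFun := fun X => ⟨⟨fun i => X.1.1 (e i), fun i => X.1.2 (e i)⟩,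
        fun a b h => X.2 _ _ h⟩
      map_one' := rfl
      map_mul' := fun _ _ => rfl
      map_zero' := rfl
      map_add' := fun _ _ => rfl
      commutes' := fun _ => rfl }
  refine ⟨(AlgEquiv.ofBijective f ⟨fun X Y h => ?_, fun Y => ?_⟩).symm⟩
  · apply Subtype.ext
    apply Subtype.ext
    funext i
    obtain ⟨i, rfl⟩ := e.surjective i
    exact congrFun (congrArg (fun Z => Z.1.1) h) i
  · obtain ⟨X, hX⟩ : ∃ X : ∀ i : Fin d.s, Matrix (Fin (d.m i)) (Fin (d.m i)) k,
        ∀ i, X (e i) = Y.1.1 i :=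
      ⟨Equiv.piCongrLeft (fun i => Matrix (Fin (d.m i)) (Fin (d.m i)) k) e Y.1.1,
        fun i => Equiv.piCongrLeft_apply_apply _ _ _ _⟩
    refine ⟨⟨⟨X, fun i => ?_⟩, ?_⟩, ?_⟩
    · obtain ⟨i, rfl⟩ := e.surjective i
      rw [hX]
      exact Y.1.2 i
    · rintro ⟨i, u⟩ ⟨j, v⟩ h
      obtain ⟨i, rfl⟩ := e.surjective i
      obtain ⟨j, rfl⟩ := e.surjective j
      change X (e i) u u = X (e j) v v
      rw [hX, hX]
      exact Y.2 ⟨i, u⟩ ⟨j, v⟩ h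
    · apply Subtype.ext
      apply Subtype.ext
      funext i
      exact hX i

/-! ### The Burban–Drozd algebra as a gentle algebra -/

/-- The index of `(i, j)` among the indices `(i,1)', (i,1), …, (i,m_i)', (i,m_i)` of the `i`-th
block of `BD(A)`. -/
def oddPos (a : d.O) : Σ i : Fin d.s, Fin (2 * d.m i) :=
  ⟨a.1, ⟨2 * a.2.1 + 1, by have := a.2.2; omega⟩⟩

theorem oddPos_injective : Function.Injective d.oddPos := by
  rintro ⟨i, u⟩ ⟨j, v⟩ h
  have h1 := congrArg Sigma.fst h
  change i = j at h1
  subst h1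
  have h2 := eq_of_heq (Sigma.mk.inj h).2
  simp only [Fin.mk.injEq] at h2
  have : u = v := Fin.ext (by omega)
  rw [this]

/-- The presentation of the Burban–Drozd algebra: the blocks are twice as long and the pairs
`(i, j)`, but not the pairs `(i, j)'`, are related as before. -/
def bd : GentleDatum where
  s := d.s
  m i := 2 * d.m i
  two_le i := by have := d.two_le i; omega
  rel a b := ∃ a' b', d.rel a' b' ∧ a = d.oddPos a' ∧ b = d.oddPos b'
  symm := by
    rintro _ _ ⟨a, b, h, rfl, rfl⟩
    exact ⟨b, a, d.symm h, rfl, rfl⟩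
  irrefl := by
    rintro _ ⟨a, b, h, rfl, h'⟩
    obtain rfl := d.oddPos_injective h'
    exact d.irrefl _ h
  unique := by
    rintro _ _ _ ⟨a, b, h, rfl, rfl⟩ ⟨a', b', h', h1, rfl⟩
    obtain rfl := d.oddPos_injective h1
    rw [d.unique h h']

/-- The splitting of the indices of a block of `BD(A)`: the index `(i, j)` belongs to row and column
`0` of the `2 × 2` matrices, and `(i, j)'` to row and column `1`. -/
def splitIdx (n : ℕ) : Fin (2 * n) ≃ Fin 2 × Fin n where
  toFun u := (⟨1 - u.1 % 2, by omega⟩, ⟨u.1 / 2, by have := u.2; omega⟩)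
  invFun x := ⟨2 * x.2.1 + (1 - x.1.1), by have := x.2.2; have := x.1.2; omega⟩
  left_inv u := by ext; simp only; omega
  right_inv x := by
    have := x.1.2
    ext <;> simp only <;> omega

/-- The order of the indices: `(i, j)'` comes directly before `(i, j)`. -/
theorem splitIdx_lt {n : ℕ} {u v : Fin (2 * n)} : u < v ↔
    (splitIdx n u).2 < (splitIdx n v).2 ∨ (splitIdx n u).2 = (splitIdx n v).2 ∧
      (splitIdx n u).1 = 1 ∧ (splitIdx n v).1 = 0 := by
  simp only [splitIdx, Equiv.coe_fn_mk, Fin.lt_def, Fin.ext_iff, Fin.val_zero, Fin.val_one]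
  omega

variable {k} in
/-- The matrix of the Burban–Drozd algebra made from a lower triangular matrix of twice the size. -/
def splitMatrix (X : d.bd.normalization k) (α β : Fin 2) : d.normalization k :=
  ⟨fun i => Matrix.of fun u v => X.1 i ((splitIdx _).symm (α, u)) ((splitIdx _).symm (β, v)),
    fun i u v h => X.2 i _ _ (splitIdx_lt.2 (Or.inl (by simpa using h)))⟩

theorem splitIdx_symm_zero (a : d.O) :
    (⟨a.1, (splitIdx (d.m a.1)).symm (0, a.2)⟩ : d.bd.O) = d.oddPos a := rfl

/-- The Burban–Drozd algebra is the gentle algebra of the presentation `d.bd`. -/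
theorem nonempty_bd_algEquiv : Nonempty (d.bd.algebra k ≃ₐ[k] d.BDAlgebra k) := by
  let f : d.bd.algebra k →ₐ[k] d.BDAlgebra k :=
    { toFun := fun X => ⟨Matrix.of (d.splitMatrix X.1), by
        constructor
        · intro a b h
          exact X.2 (d.oddPos a) (d.oddPos b) ⟨a, b, h, rfl, rfl⟩
        · refine (mem_rad _).2 fun i u => X.1.2 i _ _ (splitIdx_lt.2 (Or.inr ?_))
          simp⟩
      map_one' := by
        apply Subtype.ext
        ext α β i u v
        change (1 : Matrix (Fin (2 * d.m i)) (Fin (2 * d.m i)) k) _ _ = _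
        by_cases h : α = β
        · subst h
          change _ = ((1 : Matrix (Fin 2) (Fin 2) (d.normalization k)) α α).1 i u v
          rw [Matrix.one_apply_eq]
          change _ = (1 : Matrix (Fin (d.m i)) (Fin (d.m i)) k) u v
          simp [Matrix.one_apply]
        · change _ = ((1 : Matrix (Fin 2) (Fin 2) (d.normalization k)) α β).1 i u v
          rw [Matrix.one_apply_ne h]
          change _ = (0 : k)
          simp [h]
      map_mul' := fun X Y => by
        apply Subtype.ext
        ext α β i u v
        change _ = ((Matrix.of (d.splitMatrix X.1) * Matrix.of (d.splitMatrix Y.1)) α β).1 i u v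
        rw [Matrix.mul_apply, Fin.sum_univ_two]
        change ∑ w : Fin (2 * d.m i), X.1.1 i ((splitIdx _).symm (α, u)) w *
          Y.1.1 i w ((splitIdx _).symm (β, v)) = _
        rw [← (splitIdx (d.m i)).symm.sum_comp, Fintype.sum_prod_type, Fin.sum_univ_two]
        rfl
      map_zero' := rfl
      map_add' := fun _ _ => rfl
      commutes' := fun r => by
        apply Subtype.ext
        ext α β i u v
        change (algebraMap k (Matrix (Fin (2 * d.m i)) (Fin (2 * d.m i)) k) r) _ _ = 
          ((algebraMap k (Matrix (Fin 2) (Fin 2) (d.normalization k)) r) α β).1 i u v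
        by_cases h : α = β
        · subst h
          rw [Matrix.algebraMap_matrix_apply, Matrix.algebraMap_matrix_apply, if_pos rfl]
          change _ = (algebraMap k (Matrix (Fin (d.m i)) (Fin (d.m i)) k) r) u v
          simp [Matrix.algebraMap_matrix_apply]
        · rw [Matrix.algebraMap_matrix_apply, Matrix.algebraMap_matrix_apply, if_neg h]
          change _ = (0 : k)
          simp [h] }
  refine ⟨AlgEquiv.ofBijective f ⟨fun X Y h => ?_, fun M => ?_⟩⟩
  · apply Subtype.ext
    apply Subtype.ext
    funext i
    ext u v
    obtain ⟨⟨α, u⟩, rfl⟩ := (splitIdx (d.m i)).symm.surjective u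
    obtain ⟨⟨β, v⟩, rfl⟩ := (splitIdx (d.m i)).symm.surjective v
    exact congrArg (fun Z : d.BDAlgebra k => (Z.1 α β).1 i u v) h
  · refine ⟨⟨⟨fun i => Matrix.of fun u v =>
      (M.1 (splitIdx _ u).1 (splitIdx _ v).1).1 i (splitIdx _ u).2 (splitIdx _ v).2, ?_⟩, ?_⟩, ?_⟩
    · intro i u v h
      change (M.1 (splitIdx _ u).1 (splitIdx _ v).1).1 i (splitIdx _ u).2 (splitIdx _ v).2 = 0
      rcases splitIdx_lt.1 h with h | ⟨h, h1, h2⟩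
      · exact (M.1 _ _).2 i _ _ h
      · rw [h1, h2, h]
        exact (mem_rad _).1 M.2.2 i _
    · rintro _ _ ⟨a, b, h, rfl, rfl⟩
      have := M.2.1 a b h
      rw [← splitIdx_symm_zero, ← splitIdx_symm_zero]
      change (M.1 (splitIdx _ _).1 (splitIdx _ _).1).1 a.1 (splitIdx _ _).2 (splitIdx _ _).2 =
        (M.1 (splitIdx _ _).1 (splitIdx _ _).1).1 b.1 (splitIdx _ _).2 (splitIdx _ _).2
      simpa using this
    · apply Subtype.ext
      ext α β i u v
      change (M.1 (splitIdx _ ((splitIdx _).symm _)).1 (splitIdx _ ((splitIdx _).symm _)).1).1 i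
        (splitIdx _ ((splitIdx _).symm _)).2 (splitIdx _ ((splitIdx _).symm _)).2 = _
      simp

end Algebras

end GentleDatum

namespace GentleDatum

/-! ### The presentation determined by the algebra -/

section Reconstruction

variable {k : Type*} [Field k] {d d' : GentleDatum}

@[ext]
theorem algebra_ext {x y : d.algebra k} (h : ∀ i u v, x.1.1 i u v = y.1.1 i u v) : x = y := by
  apply Subtype.ext
  apply Subtype.ext
  funext i
  ext u v
  exact h i u v

theorem algebra_mul_apply (x y : d.algebra k) (i : Fin d.s) (u v : Fin (d.m i)) :
    (x * y).1.1 i u v = ∑ w, x.1.1 i u w * y.1.1 i w v := rfl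

/-- The character of `A` given by the diagonal entry at the pair `a`. -/
def diag (a : d.O) : d.algebra k →ₐ[k] k where
  toFun x := x.1.1 a.1 a.2 a.2
  map_one' := Matrix.one_apply_eq a.2
  map_mul' x y := normalization_mul_diag x.1 y.1 a.1 a.2
  map_zero' := rfl
  map_add' _ _ := rfl
  commutes' r := by
    change (algebraMap k (Matrix (Fin (d.m a.1)) (Fin (d.m a.1)) k) r) a.2 a.2 = r
    simp [Matrix.algebraMap_matrix_apply]

open Classical in
variable (k) in
/-- The primitive idempotent of `A` at the vertex of the pair `a`. -/
noncomputable def idem (a : d.O) : d.algebra k :=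
  ⟨⟨fun i => Matrix.diagonal fun u => if a = ⟨i, u⟩ ∨ d.rel a ⟨i, u⟩ then 1 else 0,
    fun _ _ _ h => Matrix.diagonal_apply_ne _ h.ne⟩, fun b c h => by
      simp only [Matrix.diagonal_apply_eq]
      have : (a = b ∨ d.rel a b) ↔ (a = c ∨ d.rel a c) := by
        constructor
        · rintro (rfl | h')
          · exact Or.inr h
          · exact Or.inl (d.unique (d.symm h') h)
        · rintro (rfl | h')
          · exact Or.inr (d.symm h)
          · exact Or.inl (d.unique (d.symm h') (d.symm h))
      exact if_congr this rfl rfl⟩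

open Classical in
theorem diag_idem (a b : d.O) :
    diag b (idem k a) = if a = b ∨ d.rel a b then 1 else 0 :=
  Matrix.diagonal_apply_eq _ _

theorem idem_apply_ne (a : d.O) (i : Fin d.s) {u v : Fin (d.m i)} (h : u ≠ v) :
    (idem k a).1.1 i u v = 0 :=
  Matrix.diagonal_apply_ne _ h

theorem diag_idem_self (a : d.O) : diag a (idem k a) = 1 := by
  classical
  rw [diag_idem, if_pos (Or.inl rfl)]

theorem diag_eq_of_rel {a b : d.O} (h : d.rel a b) : diag (k := k) a = diag b :=
  AlgHom.ext fun x => x.2 a b h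

theorem eq_or_rel_of_diag_eq {a b : d.O} (h : diag (k := k) a = diag b) : a = b ∨ d.rel a b := by
  classical
  by_contra hab
  have h1 := diag_idem_self (k := k) a
  rw [h, diag_idem, if_neg hab] at h1
  exact zero_ne_one h1

theorem character_eq_zero (ψ : d.algebra k →ₐ[k] k) {x : d.algebra k} (hx : ∀ a, diag a x = 0) :
    ψ x = 0 := by
  refine map_eq_zero_of_mem_jacobson (ψ : d.algebra k →+* k) (fun c => ⟨algebraMap k _ c, ?_⟩)
    ((mem_jacobson_algebra x).2 fun i u => hx ⟨i, u⟩)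
  exact ψ.commutes c

/-- The characters of `A` are the diagonal entries, and the primitive idempotents tell them
apart. -/
theorem character_eq_diag (ψ : d.algebra k →ₐ[k] k) (a : d.O) (h : ψ (idem k a) ≠ 0) :
    ψ = diag a := by
  classical
  refine AlgHom.ext fun x => mul_right_cancel₀ h ?_
  suffices h0 : ψ (x * idem k a + (-diag a x) • idem k a) = 0 by
    rwa [map_add, map_mul, map_smul, smul_eq_mul, neg_mul, ← sub_eq_add_neg, sub_eq_zero] at h0
  refine character_eq_zero ψ fun b => ?_
  rw [map_add, map_mul, map_smul, smul_eq_mul, diag_idem]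
  split_ifs with hab
  · rcases hab with rfl | hab
    · simp
    · rw [diag_eq_of_rel hab]
      simp
  · simp

open Classical in
variable (k) in
/-- The matrix unit in row `u` and column `v` of the `i`-th block. -/
noncomputable def unit (i : Fin d.s) (u v : Fin (d.m i)) (h : v < u) : d.algebra k :=
  ⟨⟨fun j => Matrix.of fun a b =>
      if (⟨j, a⟩ : d.O) = ⟨i, u⟩ ∧ (⟨j, b⟩ : d.O) = ⟨i, v⟩ then 1 else 0,
    fun j a b hab => by
      refine if_neg ?_
      rintro ⟨h1, h2⟩
      obtain rfl := congrArg Sigma.fst h1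
      obtain rfl := eq_of_heq (Sigma.mk.inj h1).2
      obtain rfl := eq_of_heq (Sigma.mk.inj h2).2
      exact lt_asymm h hab⟩,
    fun a b _ => by
      have key : ∀ c : d.O, ¬ (c = ⟨i, u⟩ ∧ c = ⟨i, v⟩) := by
        rintro c ⟨rfl, h2⟩
        exact h.ne' (eq_of_heq (Sigma.mk.inj h2).2)
      exact (if_neg (key a)).trans (if_neg (key b)).symm⟩

open Classical in
theorem unit_apply (i : Fin d.s) (u v : Fin (d.m i)) (h : v < u) (j : Fin d.s)
    (a b : Fin (d.m j)) : (unit k i u v h).1.1 j a b =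
      if (⟨j, a⟩ : d.O) = ⟨i, u⟩ ∧ (⟨j, b⟩ : d.O) = ⟨i, v⟩ then 1 else 0 := rfl

theorem unit_apply_self (i : Fin d.s) (u v : Fin (d.m i)) (h : v < u) :
    (unit k i u v h).1.1 i u v = 1 := if_pos ⟨rfl, rfl⟩

theorem diag_unit (i : Fin d.s) (u v : Fin (d.m i)) (h : v < u) (a : d.O) :
    diag a (unit k i u v h) = 0 := by
  refine if_neg ?_
  rintro ⟨h1, h2⟩
  exact h.ne' (eq_of_heq (Sigma.mk.inj (h1.symm.trans h2)).2)

/-- Left multiplication by a matrix unit. -/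
theorem unit_mul_apply (i : Fin d.s) (u v : Fin (d.m i)) (h : v < u) (x : d.algebra k)
    (w : Fin (d.m i)) : (unit k i u v h * x).1.1 i u w = x.1.1 i v w := by
  classical
  rw [algebra_mul_apply, Finset.sum_eq_single v]
  · rw [unit_apply_self, one_mul]
  · intro b _ hb
    rw [unit_apply, if_neg, zero_mul]
    rintro ⟨-, h2⟩
    exact hb (eq_of_heq (Sigma.mk.inj h2).2)
  · simp

theorem unit_mul_apply_of_ne (i : Fin d.s) (u v : Fin (d.m i)) (h : v < u) (x : d.algebra k)
    (j : Fin d.s) (a b : Fin (d.m j)) (hne : (⟨j, a⟩ : d.O) ≠ ⟨i, u⟩) :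
    (unit k i u v h * x).1.1 j a b = 0 := by
  classical
  rw [algebra_mul_apply]
  refine Finset.sum_eq_zero fun w _ => ?_
  rw [unit_apply, if_neg (fun h' => hne h'.1), zero_mul]

/-- Right multiplication by a matrix unit. -/
theorem mul_unit_apply (i : Fin d.s) (u v : Fin (d.m i)) (h : v < u) (x : d.algebra k)
    (w : Fin (d.m i)) : (x * unit k i u v h).1.1 i w v = x.1.1 i w u := by
  classical
  rw [algebra_mul_apply, Finset.sum_eq_single u]
  · rw [unit_apply_self, mul_one]
  · intro b _ hb
    rw [unit_apply, if_neg, mul_zero]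
    rintro ⟨h2, -⟩
    exact hb (eq_of_heq (Sigma.mk.inj h2).2)
  · simp

theorem unit_mul_unit (i : Fin d.s) (u v w : Fin (d.m i)) (h : v < u) (h' : w < v) :
    unit k i u v h * unit k i v w h' = unit k i u w (h'.trans h) := by
  classical
  ext j a b
  by_cases ha : (⟨j, a⟩ : d.O) = ⟨i, u⟩
  · obtain rfl := congrArg Sigma.fst ha
    obtain rfl := eq_of_heq (Sigma.mk.inj ha).2
    rw [unit_mul_apply, unit_apply, unit_apply]
    simp
  · rw [unit_mul_apply_of_ne _ _ _ _ _ _ _ _ ha, unit_apply, if_neg (fun h' => ha h'.1)]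

theorem idem_mul_apply (a : d.O) (x : d.algebra k) (j : Fin d.s) (u v : Fin (d.m j)) :
    (idem k a * x).1.1 j u v = diag ⟨j, u⟩ (idem k a) * x.1.1 j u v := by
  rw [algebra_mul_apply, Finset.sum_eq_single u]
  · rfl
  · intro w _ hw
    rw [idem_apply_ne _ _ hw.symm, zero_mul]
  · simp

theorem mul_idem_apply (a : d.O) (x : d.algebra k) (j : Fin d.s) (u v : Fin (d.m j)) :
    (x * idem k a).1.1 j u v = x.1.1 j u v * diag ⟨j, v⟩ (idem k a) := by
  rw [algebra_mul_apply, Finset.sum_eq_single v]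
  · rfl
  · intro w _ hw
    rw [idem_apply_ne _ _ hw, mul_zero]
  · simp

theorem idem_mul_unit (i : Fin d.s) (u v : Fin (d.m i)) (h : v < u) :
    idem k ⟨i, u⟩ * unit k i u v h = unit k i u v h := by
  classical
  ext j a b
  rw [idem_mul_apply, unit_apply]
  split_ifs with h'
  · rw [h'.1, diag_idem_self, one_mul]
  · rw [mul_zero]

theorem unit_mul_idem (i : Fin d.s) (u v : Fin (d.m i)) (h : v < u) :
    unit k i u v h * idem k ⟨i, v⟩ = unit k i u v h := by
  classical
  ext j a b
  rw [mul_idem_apply, unit_apply]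
  split_ifs with h'
  · rw [h'.2, diag_idem_self, one_mul]
  · rw [zero_mul]

/-- A nonzero entry of a product `e z x` with `z` in the radical. -/
theorem exists_of_mul_mul_apply_ne_zero {e z x : d.algebra k} (hz : ∀ a, diag a z = 0)
    {i : Fin d.s} {u v : Fin (d.m i)} (h : (e * (z * x)).1.1 i u v ≠ 0) :
    ∃ a b, a ≤ u ∧ b < a ∧ e.1.1 i u a ≠ 0 ∧ x.1.1 i b v ≠ 0 := by
  rw [algebra_mul_apply] at h
  obtain ⟨a, -, ha⟩ := Finset.exists_ne_zero_of_sum_ne_zero h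
  have h1 := left_ne_zero_of_mul ha
  have h2 := right_ne_zero_of_mul ha
  rw [algebra_mul_apply] at h2
  obtain ⟨b, -, hb⟩ := Finset.exists_ne_zero_of_sum_ne_zero h2
  have h3 := left_ne_zero_of_mul hb
  refine ⟨a, b, ?_, ?_, h1, right_ne_zero_of_mul hb⟩
  · by_contra hlt
    exact h1 (e.1.2 i u a (not_le.1 hlt))
  · by_contra hlt
    rcases (not_lt.1 hlt).lt_or_eq with h4 | rfl
    · exact h3 (z.1.2 i a b h4)
    · exact h3 (hz ⟨i, a⟩)

theorem diag_map_unit (φ : d.algebra k →ₐ[k] d'.algebra k) (i : Fin d.s) (u v : Fin (d.m i))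
    (h : v < u) (a : d'.O) : diag a (φ (unit k i u v h)) = 0 :=
  character_eq_zero ((diag a).comp φ) fun b => diag_unit i u v h b

/-- Every algebra homomorphism maps a path of length `t + 1` to a combination of paths of at least
the same length, and those of the same length pass through vertices whose characters restrict to
those of the vertices of the given path. -/
theorem map_unit_apply_ne_zero (φ : d.algebra k →ₐ[k] d'.algebra k) (i : Fin d.s) (t : ℕ)
    (ht : t + 1 < d.m i) (i' : Fin d'.s) (u v : Fin (d'.m i'))
    (h : (φ (unit k i ⟨t + 1, ht⟩ ⟨0, by omega⟩ (Fin.lt_def.2 (Nat.succ_pos _)))).1.1 i' u v ≠ 0) :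
    v.1 + (t + 1) ≤ u ∧ (u.1 = v + (t + 1) → ∀ r (hr : r ≤ t + 1) (w : Fin (d'.m i')),
      w.1 = v + r → diag ⟨i', w⟩ (φ (idem k ⟨i, ⟨r, by omega⟩⟩)) ≠ 0) := by
  induction t generalizing u with
  | zero =>
    rw [← idem_mul_unit, ← unit_mul_idem, map_mul, map_mul] at h
    obtain ⟨a, b, hau, hba, ha, hb⟩ := exists_of_mul_mul_apply_ne_zero (diag_map_unit φ _ _ _ _) h
    have hvb : v ≤ b := by
      by_contra hlt
      exact hb ((φ _).1.2 i' b v (not_le.1 hlt))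
    rw [Fin.le_def] at hau hvb
    rw [Fin.lt_def] at hba
    refine ⟨by omega, fun huv r hr w hw => ?_⟩
    obtain rfl : a = u := Fin.ext (by omega)
    obtain rfl : v = b := Fin.ext (by omega)
    obtain rfl | rfl : r = 0 ∨ r = 1 := by omega
    · obtain rfl : w = v := Fin.ext (by omega)
      exact hb
    · obtain rfl : w = a := Fin.ext (by omega)
      exact ha
  | succ t ih =>
    rw [← unit_mul_unit i _ ⟨t + 1, by omega⟩ _ (Fin.lt_def.2 (Nat.lt_succ_self _))
      (Fin.lt_def.2 (Nat.succ_pos _)), ← idem_mul_unit, mul_assoc, map_mul, map_mul] at h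
    obtain ⟨a, b, hau, hba, ha, hb⟩ := exists_of_mul_mul_apply_ne_zero (diag_map_unit φ _ _ _ _) h
    obtain ⟨h1, h2⟩ := ih (by omega) b hb
    rw [Fin.le_def] at hau
    rw [Fin.lt_def] at hba
    refine ⟨by omega, fun huv r hr w hw => ?_⟩
    obtain rfl : a = u := Fin.ext (by omega)
    rcases Nat.lt_or_ge r (t + 2) with hr' | hr'
    · exact h2 (by omega) r (by omega) w hw
    · obtain rfl : r = t + 2 := by omega
      obtain rfl : w = a := Fin.ext (by omega)
      exact ha

/-- The last index of a block. -/
def last (i : Fin d.s) : Fin (d.m i) := ⟨d.m i - 1, by have := d.two_le i; omega⟩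

/-- The first index of a block. -/
def first (i : Fin d.s) : Fin (d.m i) := ⟨0, by have := d.two_le i; omega⟩

theorem first_lt_last (i : Fin d.s) : first i < last i :=
  Fin.lt_def.2 (by have := d.two_le i; simp only [first, last]; omega)

variable (k) in
/-- The longest path of a block, which is the matrix unit in the lower left corner. -/
noncomputable def corner (i : Fin d.s) : d.algebra k :=
  unit k i (last i) (first i) (first_lt_last i)

open Classical in
theorem corner_apply (i j : Fin d.s) :
    (corner k i).1.1 j (last j) (first j) = if i = j then 1 else 0 := by
  split_ifs with h
  · subst h
    exact unit_apply_self _ _ _ _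
  · exact if_neg fun h' => h (congrArg Sigma.fst h'.1).symm

/-- The elements annihilated by the radical on both sides are the combinations of the longest paths
of the blocks. -/
theorem eq_sum_corner (x : d.algebra k)
    (hx : ∀ y : d.algebra k, (∀ a, diag a y = 0) → y * x = 0 ∧ x * y = 0) :
    x = ∑ i, x.1.1 i (last i) (first i) • corner k i := by
  classical
  have h0 : ∀ i (u v : Fin (d.m i)), ¬ (u = last i ∧ v = first i) → x.1.1 i u v = 0 := by
    intro i u v huv
    rw [not_and_or] at huv
    rcases huv with hu | hv
    · have hu' : u.1 + 1 < d.m i := by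
        have h1 := u.2
        have : u.1 ≠ d.m i - 1 := fun h => hu (Fin.ext h)
        omega
      have h2 : u < ⟨u.1 + 1, hu'⟩ := Fin.lt_def.2 (Nat.lt_succ_self _)
      rw [← unit_mul_apply i _ u h2 x v, (hx _ (diag_unit _ _ _ h2)).1]
      rfl
    · have hv' : v.1 ≠ 0 := fun h => hv (Fin.ext h)
      have h2 : (⟨v.1 - 1, by omega⟩ : Fin (d.m i)) < v := Fin.lt_def.2 (by simp only; omega)
      rw [← mul_unit_apply i v _ h2 x u, (hx _ (diag_unit _ _ _ h2)).2]
      rfl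
  ext j u v
  let p : d.algebra k →ₗ[k] k :=
    { toFun := fun y => y.1.1 j u v
      map_add' := fun _ _ => rfl
      map_smul' := fun _ _ => rfl }
  change p x = p (∑ i, x.1.1 i (last i) (first i) • corner k i)
  rw [map_sum, Finset.sum_eq_single j]
  · rw [map_smul]
    change x.1.1 j u v = _ * (corner k j).1.1 j u v
    by_cases h : u = last j ∧ v = first j
    · rw [h.1, h.2, corner_apply, if_pos rfl, mul_one]
    · rw [h0 j u v h, corner, unit_apply, if_neg, mul_zero]
      rintro ⟨h1, h2⟩
      exact h ⟨eq_of_heq (Sigma.mk.inj h1).2, eq_of_heq (Sigma.mk.inj h2).2⟩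
  · intro i _ hi
    rw [map_smul]
    change _ * (corner k i).1.1 j u v = 0
    rw [corner, unit_apply, if_neg, mul_zero]
    exact fun h' => hi (congrArg Sigma.fst h'.1).symm
  · simp

theorem mul_corner (i : Fin d.s) {y : d.algebra k} (hy : ∀ a, diag a y = 0) :
    y * corner k i = 0 ∧ corner k i * y = 0 := by
  classical
  constructor
  · ext j u v
    rw [algebra_mul_apply]
    refine Finset.sum_eq_zero fun w _ => ?_
    rw [corner, unit_apply]
    split_ifs with h
    · rcases lt_or_ge u w with h1 | h1
      · rw [y.1.2 j u w h1, zero_mul]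
      · obtain rfl := congrArg Sigma.fst h.1
        obtain rfl : w = last j := eq_of_heq (Sigma.mk.inj h.1).2
        have h2 := u.2
        obtain rfl : u = last j := Fin.ext (by
          rw [Fin.le_def] at h1; simp only [last] at h1 ⊢; omega)
        rw [show y.1.1 j (last j) (last j) = 0 from hy ⟨j, last j⟩, zero_mul]
    · rw [mul_zero]
  · ext j u v
    rw [algebra_mul_apply]
    refine Finset.sum_eq_zero fun w _ => ?_
    rw [corner, unit_apply]
    split_ifs with h
    · rcases lt_or_ge w v with h1 | h1
      · rw [y.1.2 j w v h1, mul_zero]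
      · obtain rfl := congrArg Sigma.fst h.2
        obtain rfl : w = first j := eq_of_heq (Sigma.mk.inj h.2).2
        obtain rfl : v = first j := Fin.ext (by
          rw [Fin.le_def] at h1; simp only [first] at h1 ⊢; omega)
        rw [show y.1.1 j (first j) (first j) = 0 from hy ⟨j, first j⟩, mul_zero]
    · rw [zero_mul]

/-- The matrix of the map induced by an isomorphism on the spans of the longest paths. -/
noncomputable def cornerMatrix (φ : d.algebra k ≃ₐ[k] d'.algebra k) :
    Matrix (Fin d.s) (Fin d'.s) k :=
  Matrix.of fun i i' => (φ (corner k i)).1.1 i' (last i') (first i')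

theorem cornerMatrix_mul (φ : d.algebra k ≃ₐ[k] d'.algebra k) :
    cornerMatrix φ * cornerMatrix φ.symm = 1 := by
  classical
  ext i j
  rw [Matrix.mul_apply, Matrix.one_apply, ← corner_apply (k := k)]
  have h1 : φ (corner k i) = _ := eq_sum_corner _ fun y hy => by
    have h2 := mul_corner (k := k) i (y := φ.symm y) fun a =>
      character_eq_zero ((diag a).comp φ.symm.toAlgHom) hy
    constructor
    · rw [← φ.apply_symm_apply y, ← map_mul, h2.1, map_zero]
    · rw [← φ.apply_symm_apply y, ← map_mul, h2.2, map_zero]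
  have h2 := congrArg φ.symm h1
  rw [φ.symm_apply_apply, map_sum] at h2
  let p : d.algebra k →ₗ[k] k :=
    { toFun := fun y => y.1.1 j (last j) (first j)
      map_add' := fun _ _ => rfl
      map_smul' := fun _ _ => rfl }
  have h3 := congrArg p h2
  rw [map_sum] at h3
  simp only [map_smul] at h3
  exact h3.symm

/-- A permutation along which the entries of an invertible matrix do not vanish. -/
theorem exists_equiv_cornerMatrix_ne_zero (φ : d.algebra k ≃ₐ[k] d'.algebra k) :
    ∃ e : Fin d.s ≃ Fin d'.s, ∀ i, cornerMatrix φ i (e i) ≠ 0 := by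
  have h1 := cornerMatrix_mul φ
  have h2 := cornerMatrix_mul φ.symm
  rw [AlgEquiv.symm_symm] at h2
  have hc := Matrix.square_of_invertible _ _ h2 h1
  obtain ⟨e⟩ : Nonempty (Fin d.s ≃ Fin d'.s) := Fintype.card_eq.1 hc.symm
  have h3 : (cornerMatrix φ).submatrix id e * (cornerMatrix φ.symm).submatrix e id = 1 := by
    rw [Matrix.submatrix_mul_equiv, h1, Matrix.submatrix_id_id]
  have h4 : ((cornerMatrix φ).submatrix id e).det ≠ 0 := by
    intro h
    have := congrArg Matrix.det h3
    rw [Matrix.det_mul, h, zero_mul, Matrix.det_one] at this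
    exact zero_ne_one this
  rw [Matrix.det_apply'] at h4
  obtain ⟨τ, -, hτ⟩ := Finset.exists_ne_zero_of_sum_ne_zero h4
  have h5 := right_ne_zero_of_mul hτ
  rw [Finset.prod_ne_zero_iff] at h5
  refine ⟨τ.symm.trans e, fun i => ?_⟩
  have := h5 (τ.symm i) (Finset.mem_univ _)
  simpa using this

theorem le_of_cornerMatrix_ne_zero (φ : d.algebra k ≃ₐ[k] d'.algebra k) {i : Fin d.s}
    {i' : Fin d'.s} (h : cornerMatrix φ i i' ≠ 0) :
    d.m i ≤ d'.m i' ∧ (d.m i = d'.m i' → ∀ r (hr : r < d.m i) (hr' : r < d'.m i'),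
      diag ⟨i', ⟨r, hr'⟩⟩ (φ (idem k ⟨i, ⟨r, hr⟩⟩)) ≠ 0) := by
  have h2 := d.two_le i
  have h2' := d'.two_le i'
  obtain ⟨t, ht⟩ : ∃ t, d.m i = t + 2 := ⟨d.m i - 2, by omega⟩
  have hl : last i = ⟨t + 1, by omega⟩ := Fin.ext (by simp only [last]; omega)
  have h3 : (φ (corner k i)).1.1 i' (last i') (first i') ≠ 0 := h
  simp only [corner, hl] at h3
  obtain ⟨h4, h5⟩ := map_unit_apply_ne_zero φ.toAlgHom i t (by omega) i' _ _ h3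
  simp only [last, first] at h4 h5
  refine ⟨by omega, fun hm r hr hr' => h5 (by omega) r (by omega) _ (by simp)⟩

/-- The algebra `A(𝐦, ≃)` determines the presentation up to a permutation of the blocks. -/
theorem eq_reindex_of_algEquiv (φ : d.algebra k ≃ₐ[k] d'.algebra k) :
    ∃ e : Fin d.s ≃ Fin d'.s, d = d'.reindex e := by
  obtain ⟨e, he⟩ := exists_equiv_cornerMatrix_ne_zero φ
  obtain ⟨e', he'⟩ := exists_equiv_cornerMatrix_ne_zero φ.symm
  have hle : ∀ i ∈ Finset.univ, d.m i ≤ d'.m (e i) :=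
    fun i _ => (le_of_cornerMatrix_ne_zero φ (he i)).1
  have hsum : ∑ i, d.m i = ∑ i, d'.m (e i) := by
    refine le_antisymm (Finset.sum_le_sum hle) ?_
    rw [e.sum_comp d'.m, ← e'.sum_comp d.m]
    exact Finset.sum_le_sum fun i _ => (le_of_cornerMatrix_ne_zero φ.symm (he' i)).1
  have hm : ∀ i, d.m i = d'.m (e i) := fun i =>
    (Finset.sum_eq_sum_iff_of_le hle).1 hsum i (Finset.mem_univ i)
  let f : d.O → d'.O := fun a => ⟨e a.1, Fin.cast (hm _) a.2⟩
  have hf : ∀ a, ((diag (f a)).comp φ.toAlgHom : d.algebra k →ₐ[k] k) = diag a := fun a =>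
    character_eq_diag _ a ((le_of_cornerMatrix_ne_zero φ (he a.1)).2 (hm _) a.2.1 a.2.2 _)
  have hinj : Function.Injective f := by
    rintro ⟨i, u⟩ ⟨j, v⟩ h
    obtain rfl := e.injective (congrArg Sigma.fst h)
    obtain rfl : u = v := Fin.cast_injective _ (eq_of_heq (Sigma.mk.inj h).2)
    rfl
  refine ⟨e, eq_reindex _ _ e hm fun a b => ?_⟩
  change d.rel a b ↔ d'.rel (f a) (f b)
  constructor
  · intro h
    have h1 := diag_eq_of_rel (k := k) h
    rw [← hf, ← hf] at h1
    have h2 : diag (k := k) (f a) = diag (f b) := AlgHom.ext fun x => by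
      have := DFunLike.congr_fun h1 (φ.symm x)
      simpa using this
    rcases eq_or_rel_of_diag_eq h2 with h3 | h3
    · rw [hinj h3] at h
      exact (d.irrefl _ h).elim
    · exact h3
  · intro h
    have h1 : diag (k := k) a = diag b := by
      rw [← hf, ← hf, diag_eq_of_rel h]
    rcases eq_or_rel_of_diag_eq h1 with h3 | h3
    · rw [h3] at h
      exact (d'.irrefl _ h).elim
    · exact h3

end Reconstruction

end GentleDatum

namespace MarkedSurface

/-! ### The polygons -/

/-- The point of the boundary circle of the `(m + 1)`-gon with parameter `x`, the `j`-th edge being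
the interval `[j, j + 1]`. -/
noncomputable def circ (m : ℕ) (x : ℝ) : Disc :=
  ⟨Circle.exp (2 * Real.pi * x / (m + 1)), by
    rw [mem_closedBall_zero_iff]; exact (Circle.norm_coe _).le⟩

theorem edge_eq_circ (m j : ℕ) (t : I) : edge m j t = circ m (j + (t : ℝ)) := rfl

theorem continuous_circ (m : ℕ) : Continuous (circ m) := by
  unfold circ
  fun_prop

theorem continuous_edge (m j : ℕ) : Continuous (edge m j) :=
  (continuous_circ m).comp (by fun_prop)

theorem circ_eq_circ {m : ℕ} {x y : ℝ} :
    circ m x = circ m y ↔ ∃ n : ℤ, x = y + n * (m + 1) := by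
  have hm : (0 : ℝ) < m + 1 := by positivity
  rw [circ, circ, Subtype.mk.injEq, ← Circle.ext_iff, Circle.exp_eq_exp]
  refine exists_congr fun n => ?_
  have hpi := Real.pi_pos
  constructor
  · intro h
    field_simp at h
    linarith
  · rintro rfl
    field_simp

/-- The parameter on the boundary circle is unique up to the identification of the end points of
an interval of length `m + 1`. -/
theorem eq_of_circ_eq {m : ℕ} {x y : ℝ} (h : circ m x = circ m y) (h1 : x - y < m + 1)
    (h2 : y - x < m + 1) : x = y := by
  obtain ⟨n, hn⟩ := circ_eq_circ.1 h
  have hm : (0 : ℝ) < m + 1 := by positivity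
  have h3 : n < 1 := by
    by_contra hc
    have : (1 : ℝ) ≤ n := by exact_mod_cast not_lt.1 hc
    nlinarith
  have h4 : -1 < n := by
    by_contra hc
    have : (n : ℝ) ≤ -1 := by exact_mod_cast not_lt.1 hc
    nlinarith
  obtain rfl : n = 0 := by omega
  simpa using hn

theorem edge_injective {m : ℕ} (hm : 1 ≤ m) (j : ℕ) : Function.Injective (edge m j) := by
  intro t t' h
  have hm' : (1 : ℝ) ≤ m := by exact_mod_cast hm
  have h1 := t.2.1
  have h2 := t.2.2
  have h3 := t'.2.1
  have h4 := t'.2.2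
  have := eq_of_circ_eq (x := j + t) (y := j + t') h (by linarith) (by linarith)
  exact Subtype.ext (by linarith)

theorem edge_one (m j : ℕ) : edge m j 1 = edge m (j + 1) 0 := by
  simp [edge_eq_circ]

theorem edge_last (m : ℕ) : edge m (m + 1) 0 = edge m 0 0 := by
  rw [edge_eq_circ, edge_eq_circ, circ_eq_circ]
  exact ⟨1, by simp⟩

theorem edge_eq_edge {m j j' : ℕ} (hj : j ≤ m) (hj' : j' ≤ m) {t t' : I} (h0 : 0 < t) (h1 : t < 1)
    (h : edge m j t = edge m j' t') : j = j' ∧ t = t' := by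
  have h0 : (0 : ℝ) < t := h0
  have h1 : (t : ℝ) < 1 := h1
  have h2 := t'.2.1
  have h3 := t'.2.2
  have hjr : (j : ℝ) ≤ m := by exact_mod_cast hj
  have hjr' : (j' : ℝ) ≤ m := by exact_mod_cast hj'
  have hp : (0 : ℝ) ≤ j := by positivity
  have hp' : (0 : ℝ) ≤ j' := by positivity
  have := eq_of_circ_eq (x := j + t) (y := j' + t') h (by linarith) (by linarith)
  have h4 : j < j' + 1 := by
    have : (j : ℝ) < j' + 1 := by linarith
    exact_mod_cast this
  have h5 : j' < j + 1 := by
    have : (j' : ℝ) < j + 1 := by linarith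
    exact_mod_cast this
  obtain rfl : j = j' := by omega
  exact ⟨rfl, Subtype.ext (by linarith)⟩

/-- The vertices of the `(m + 1)`-gon. -/
def vertices (m : ℕ) : Set Disc := {p | ∃ j, j ≤ m ∧ p = edge m j 0}

theorem edge_mem_vertices {m j : ℕ} (hj : j ≤ m) {t : I} :
    edge m j t ∈ vertices m ↔ t = 0 ∨ t = 1 := by
  constructor
  · rintro ⟨j', hj', h⟩
    by_contra! ht
    have h0 := (unitInterval.pos_iff_ne_zero (x := t)).2 ht.1
    have h1 := (unitInterval.lt_one_iff_ne_one (x := t)).2 ht.2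
    exact ht.1 (edge_eq_edge hj hj' h0 h1 h).2
  · rintro (rfl | rfl)
    · exact ⟨j, hj, rfl⟩
    · rw [edge_one]
      rcases hj.lt_or_eq with hj | rfl
      · exact ⟨j + 1, hj, rfl⟩
      · exact ⟨0, Nat.zero_le _, edge_last _⟩

theorem finite_vertices (m : ℕ) : (vertices m).Finite := by
  refine ((Set.finite_Iic m).image fun j => edge m j 0).subset ?_
  rintro _ ⟨j, hj, rfl⟩
  exact ⟨j, hj, rfl⟩

theorem half_pos : 0 < half := by
  rw [← Subtype.coe_lt_coe]; norm_num [half]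

theorem half_lt_one : half < 1 := by
  rw [← Subtype.coe_lt_coe]; norm_num [half]

theorem symm_half : unitInterval.symm half = half := by
  apply Subtype.ext
  norm_num [half]

end MarkedSurface

namespace GentleDatum

open MarkedSurface

variable (d : GentleDatum)

/-! ### The gluing of the polygons -/

/-- The points of the disjoint union of the polygons. -/
abbrev Discs : Type := Σ _ : d.PolyIdx, Disc

/-- The projection from the polygons to the marked surface. -/
def quo : d.Discs → d.surface.carrier := d.proj

theorem isQuotientMap_quo : Topology.IsQuotientMap d.quo :=
  isQuotientMap_quot_mk (r := d.Glue)

/-- The edges of the polygons other than the boundary edges. -/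
abbrev Side : Type := d.O ⊕ {a : d.O // ¬ d.Glued a}

/-- The polygon to which a side belongs. -/
def Side.poly {d : GentleDatum} : d.Side → d.PolyIdx := Sum.map (fun a => a.1) id

/-- The number of a side among the edges of its polygon. -/
def Side.num {d : GentleDatum} : d.Side → ℕ := Sum.elim (fun a => a.2 + 1) fun _ => 1

/-- The point of a side with parameter `t`. -/
noncomputable def sidePt (s : d.Side) (t : I) : d.Discs :=
  ⟨s.poly, edge (d.polySize s.poly) s.num t⟩

open Classical in
/-- The side to which a side is glued. -/
noncomputable def opp : d.Side → d.Side
  | .inl a => if h : d.Glued a then .inl h.choose else .inr ⟨a, h⟩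
  | .inr a => .inl a.1

variable {d}

theorem opp_inl_of_rel {a b : d.O} (h : d.rel a b) : d.opp (.inl a) = .inl b := by
  have h' : d.Glued a := ⟨b, h⟩
  rw [opp, dif_pos h', d.unique h'.choose_spec h]

theorem opp_inl_of_not_glued {a : d.O} (h : ¬ d.Glued a) : d.opp (.inl a) = .inr ⟨a, h⟩ :=
  dif_neg h

theorem opp_inr (a : {a : d.O // ¬ d.Glued a}) : d.opp (.inr a) = .inl a.1 := rfl

theorem opp_opp (s : d.Side) : d.opp (d.opp s) = s := by
  rcases s with a | a
  · by_cases h : d.Glued a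
    · obtain ⟨b, h⟩ := h
      rw [opp_inl_of_rel h, opp_inl_of_rel (d.symm h)]
    · rw [opp_inl_of_not_glued h, opp_inr]
  · rw [opp_inr, opp_inl_of_not_glued a.2]

theorem rel_iff_opp {a b : d.O} : d.rel a b ↔ d.opp (.inl a) = .inl b := by
  refine ⟨opp_inl_of_rel, fun h => ?_⟩
  by_cases h' : d.Glued a
  · obtain ⟨c, hc⟩ := h'
    rw [opp_inl_of_rel hc, Sum.inl.injEq] at h
    rwa [← h]
  · rw [opp_inl_of_not_glued h'] at h
    cases h

theorem opp_ne (s : d.Side) : d.opp s ≠ s := by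
  rcases s with a | a
  · exact fun h => d.irrefl a (rel_iff_opp.2 h)
  · rw [opp_inr]
    exact Sum.inl_ne_inr

theorem one_le_polySize (p : d.PolyIdx) : 1 ≤ d.polySize p := by
  rcases p with i | a
  · have := d.two_le i
    simp only [polySize, Sum.elim_inl]
    omega
  · exact le_rfl

theorem Side.one_le_num (s : d.Side) : 1 ≤ s.num := by
  rcases s with a | a <;> simp [Side.num]

theorem Side.num_le (s : d.Side) : s.num ≤ d.polySize s.poly := by
  rcases s with a | a
  · exact a.2.2
  · exact le_rfl

theorem Side.exists_eq (p : d.PolyIdx) {j : ℕ} (h1 : 1 ≤ j) (h2 : j ≤ d.polySize p) :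
    ∃ s : d.Side, s.poly = p ∧ s.num = j := by
  rcases p with i | a
  · exact ⟨.inl ⟨i, ⟨j - 1, by
      change j ≤ d.m i at h2
      omega⟩⟩, rfl, by simp only [Side.num, Sum.elim_inl]; omega⟩
  · change j ≤ 1 at h2
    exact ⟨.inr a, rfl, by simp only [Side.num, Sum.elim_inr]; omega⟩

theorem Side.ext {s s' : d.Side} (h1 : s.poly = s'.poly) (h2 : s.num = s'.num) : s = s' := by
  rcases s with ⟨i, u⟩ | a <;> rcases s' with ⟨i', u'⟩ | a'
  · obtain rfl : i = i' := Sum.inl_injective h1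
    obtain rfl : u = u' := Fin.ext (Nat.succ_injective h2)
    rfl
  · cases h1
  · cases h1
  · obtain rfl : a = a' := Sum.inr_injective h1
    rfl

theorem continuous_sidePt (s : d.Side) : Continuous (d.sidePt s) :=
  continuous_sigmaMk.comp (continuous_edge _ _)

theorem sidePt_injective (s : d.Side) : Function.Injective (d.sidePt s) :=
  sigma_mk_injective.comp (edge_injective (one_le_polySize _) _)

theorem eq_of_sidePt_eq {s s' : d.Side} {t t' : I} (h0 : 0 < t) (h1 : t < 1)
    (h : d.sidePt s t = d.sidePt s' t') : s = s' ∧ t = t' := by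
  have h2 : s.poly = s'.poly := congrArg Sigma.fst h
  have h3 : edge (d.polySize s.poly) s.num t = edge (d.polySize s'.poly) s'.num t' :=
    eq_of_heq (Sigma.mk.inj h).2
  have h4 := s'.num_le
  rw [← h2] at h3 h4
  obtain ⟨h5, h6⟩ := edge_eq_edge s.num_le h4 h0 h1 h3
  exact ⟨Side.ext h2 h5, h6⟩

variable (d) in
/-- The vertices of the polygons. -/
def Vertex (x : d.Discs) : Prop := x.2 ∈ vertices (d.polySize x.1)

theorem vertex_sidePt {s : d.Side} {t : I} : d.Vertex (d.sidePt s t) ↔ t = 0 ∨ t = 1 :=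
  edge_mem_vertices s.num_le

theorem finite_vertex : {x | d.Vertex x}.Finite := by
  refine (Set.finite_iUnion fun p : d.PolyIdx =>
    (finite_vertices (d.polySize p)).image (Sigma.mk (β := fun _ => Disc) p)).subset ?_
  rintro ⟨p, z⟩ h
  exact Set.mem_iUnion.2 ⟨p, z, h, rfl⟩

theorem exists_of_glue {x y : d.Discs} (h : d.Glue x y) :
    ∃ s t, x = d.sidePt s t ∧ y = d.sidePt (d.opp s) (unitInterval.symm t) := by
  rcases h with ⟨a, b, h, t⟩ | ⟨a, h, t⟩
  · exact ⟨.inl a, t, rfl, by rw [opp_inl_of_rel h]; rfl⟩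
  · exact ⟨.inr ⟨a, h⟩, t, rfl, rfl⟩

theorem quo_sidePt_opp (s : d.Side) (t : I) :
    d.quo (d.sidePt (d.opp s) (unitInterval.symm t)) = d.quo (d.sidePt s t) := by
  rcases s with a | a
  · by_cases h : d.Glued a
    · obtain ⟨b, h⟩ := h
      rw [opp_inl_of_rel h]
      exact (Quot.sound (Glue.inv a b h t)).symm
    · rw [opp_inl_of_not_glued h]
      have := Glue.bij a h (unitInterval.symm t)
      rw [unitInterval.symm_symm] at this
      exact Quot.sound this
  · exact (Quot.sound (Glue.bij a.1 a.2 t)).symm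

/-- A map that takes the same values on glued points factors through the surface. -/
theorem apply_eq_of_quo_eq {Z : Type*} (g : d.Discs → Z)
    (hg : ∀ s t, g (d.sidePt s t) = g (d.sidePt (d.opp s) (unitInterval.symm t)))
    {x y : d.Discs} (h : d.quo x = d.quo y) : g x = g y := by
  have hg' : ∀ x y, d.Glue x y → g x = g y := by
    intro x y h
    obtain ⟨s, t, rfl, rfl⟩ := exists_of_glue h
    exact hg s t
  exact congrArg (Quot.lift g hg') h

/-- The points identified in the surface: besides vertices, only the points of two glued sides. -/
theorem quo_eq {x y : d.Discs} (h : d.quo x = d.quo y) :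
    x = y ∨ (d.Vertex x ∧ d.Vertex y) ∨
      ∃ s t, 0 < t ∧ t < 1 ∧ x = d.sidePt s t ∧ y = d.sidePt (d.opp s) (unitInterval.symm t) := by
  have h' : Relation.EqvGen d.Glue x y := Quot.eqvGen_exact h
  have symm0 : ∀ t : I, 0 < t → unitInterval.symm t < 1 := fun t ht => by
    rw [← Subtype.coe_lt_coe] at *
    simpa using ht
  have symm1 : ∀ t : I, t < 1 → 0 < unitInterval.symm t := fun t ht => by
    rw [← Subtype.coe_lt_coe] at *
    simpa using ht
  clear h
  induction h' with
  | rel x y h =>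
    obtain ⟨s, t, rfl, rfl⟩ := exists_of_glue h
    by_cases ht : t = 0 ∨ t = 1
    · refine Or.inr (Or.inl ⟨vertex_sidePt.2 ht, vertex_sidePt.2 ?_⟩)
      rcases ht with rfl | rfl <;> simp
    · push Not at ht
      exact Or.inr (Or.inr ⟨s, t, unitInterval.pos_iff_ne_zero.2 ht.1,
        unitInterval.lt_one_iff_ne_one.2 ht.2, rfl, rfl⟩)
  | refl x => exact Or.inl rfl
  | symm x y _ ih =>
    rcases ih with rfl | ⟨h1, h2⟩ | ⟨s, t, h0, h1, rfl, rfl⟩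
    · exact Or.inl rfl
    · exact Or.inr (Or.inl ⟨h2, h1⟩)
    · exact Or.inr (Or.inr ⟨d.opp s, unitInterval.symm t, symm1 t h1, symm0 t h0, rfl, by
        rw [opp_opp, unitInterval.symm_symm]⟩)
  | trans x y z _ _ ih1 ih2 =>
    rcases ih1 with rfl | ⟨h1, h2⟩ | ⟨s, t, h0, h1, rfl, rfl⟩
    · exact ih2
    · rcases ih2 with rfl | ⟨h3, h4⟩ | ⟨s, t, h3, h4, rfl, rfl⟩
      · exact Or.inr (Or.inl ⟨h1, h2⟩)
      · exact Or.inr (Or.inl ⟨h1, h4⟩)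
      · rcases vertex_sidePt.1 h2 with rfl | rfl
        · exact (lt_irrefl _ h3).elim
        · exact (lt_irrefl _ h4).elim
    · rcases ih2 with h | ⟨h3, h4⟩ | ⟨s', t', h3, h4, h, rfl⟩
      · rw [← h]
        exact Or.inr (Or.inr ⟨s, t, h0, h1, rfl, rfl⟩)
      · rcases vertex_sidePt.1 h3 with h | h
        · exact ((symm1 t h1).ne' h).elim
        · exact ((symm0 t h0).ne h).elim
      · obtain ⟨rfl, rfl⟩ := eq_of_sidePt_eq (symm1 t h1) (symm0 t h0) h
        left
        rw [opp_opp, unitInterval.symm_symm]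

theorem vertex_of_quo_eq {x y : d.Discs} (h : d.quo x = d.quo y) (hx : d.Vertex x) :
    d.Vertex y := by
  rcases quo_eq h with rfl | ⟨-, h⟩ | ⟨s, t, h0, h1, rfl, rfl⟩
  · exact hx
  · exact h
  · rcases vertex_sidePt.1 hx with rfl | rfl
    · exact (lt_irrefl _ h0).elim
    · exact (lt_irrefl _ h1).elim

variable (d) in
/-- The points of the sides. -/
def OnSide (x : d.Discs) : Prop := ∃ s t, x = d.sidePt s t

theorem Vertex.onSide {x : d.Discs} (h : d.Vertex x) : d.OnSide x := by
  obtain ⟨p, z⟩ := x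
  obtain ⟨j, hj, hz⟩ := h
  change z = edge (d.polySize p) j 0 at hz
  change j ≤ d.polySize p at hj
  subst hz
  by_cases h0 : j = 0
  · obtain ⟨s, rfl, hs⟩ := Side.exists_eq p (one_le_polySize p) le_rfl
    refine ⟨s, 1, ?_⟩
    rw [sidePt, edge_one, hs, edge_last, h0]
  · obtain ⟨s, rfl, hs⟩ := Side.exists_eq p (Nat.one_le_iff_ne_zero.2 h0) hj
    exact ⟨s, 0, by rw [sidePt, hs]⟩

/-- The points outside the sides are not identified with any other points. -/
theorem eq_of_quo_eq {x y : d.Discs} (hx : ¬ d.OnSide x) (h : d.quo x = d.quo y) : x = y := by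
  rcases quo_eq h with h | ⟨h, -⟩ | ⟨s, t, -, -, rfl, -⟩
  · exact h
  · exact (hx h.onSide).elim
  · exact (hx ⟨s, t, rfl⟩).elim

theorem onSide_of_quo_eq {x y : d.Discs} (h : d.quo x = d.quo y) (hx : d.OnSide x) :
    d.OnSide y := by
  by_contra hy
  rw [eq_of_quo_eq hy h.symm] at hy
  exact hy hx

theorem not_onSide_boundary (p : d.PolyIdx) {t : I} (h0 : 0 < t) (h1 : t < 1) :
    ¬ d.OnSide ⟨p, edge (d.polySize p) 0 t⟩ := by
  rintro ⟨s, t', h⟩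
  obtain rfl : p = s.poly := congrArg Sigma.fst h
  have h3 : edge (d.polySize s.poly) 0 t = edge (d.polySize s.poly) s.num t' :=
    eq_of_heq (Sigma.mk.inj h).2
  have h2 := (edge_eq_edge (Nat.zero_le _) s.num_le h0 h1 h3).1
  have := s.one_le_num
  omega

/-- The projection to the surface is a closed map. -/
theorem isClosedMap_quo : IsClosedMap d.quo := by
  intro C hC
  rw [← d.isQuotientMap_quo.isClosed_preimage]
  have : d.quo ⁻¹' (d.quo '' C) = C ∪ ({x | d.Vertex x} ∩ d.quo ⁻¹' (d.quo '' C)) ∪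
      ⋃ s : d.Side, (fun t => d.sidePt (d.opp s) (unitInterval.symm t)) '' (d.sidePt s ⁻¹' C) := by
    apply Set.Subset.antisymm
    · rintro y ⟨x, hx, h⟩
      rcases quo_eq h with rfl | ⟨-, h'⟩ | ⟨s, t, -, -, rfl, rfl⟩
      · exact Or.inl (Or.inl hx)
      · exact Or.inl (Or.inr ⟨h', x, hx, h⟩)
      · exact Or.inr (Set.mem_iUnion.2 ⟨s, t, hx, rfl⟩)
    · rintro y ((hy | ⟨-, hy⟩) | hy)
      · exact ⟨y, hy, rfl⟩
      · exact hy
      · obtain ⟨s, t, ht, rfl⟩ := Set.mem_iUnion.1 hy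
        exact ⟨_, ht, (quo_sidePt_opp s t).symm⟩
  rw [this]
  refine (hC.union (finite_vertex.subset Set.inter_subset_left).isClosed).union
    (isClosed_iUnion_of_finite fun s => IsCompact.isClosed ?_)
  exact (hC.preimage (continuous_sidePt s)).isCompact.image
    ((continuous_sidePt _).comp unitInterval.continuous_symm)

theorem finite_quo_fiber (z : d.surface.carrier) : (d.quo ⁻¹' {z}).Finite := by
  obtain ⟨x, rfl⟩ := d.isQuotientMap_quo.surjective z
  have : d.quo ⁻¹' {d.quo x} ⊆ {x} ∪ {y | d.Vertex y} ∪
      ⋃ s : d.Side, (fun t => d.sidePt (d.opp s) (unitInterval.symm t)) ''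
        {t | x = d.sidePt s t} := by
    rintro y hy
    rcases quo_eq (Eq.symm hy) with rfl | ⟨-, h'⟩ | ⟨s, t, -, -, rfl, rfl⟩
    · exact Or.inl (Or.inl rfl)
    · exact Or.inl (Or.inr h')
    · exact Or.inr (Set.mem_iUnion.2 ⟨s, t, rfl, rfl⟩)
  refine Set.Finite.subset (((Set.finite_singleton x).union finite_vertex).union
    (Set.finite_iUnion fun s => Set.Finite.image _ (Set.Subsingleton.finite ?_))) this
  intro t ht t' ht'
  exact sidePt_injective s ((Eq.symm ht).trans ht')

/-! ### Maps out of a surface -/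

theorem surface_closedPts : d.surface.closedPts = d.quo '' {x | d.Vertex x} := rfl

variable (d) in
/-- The points of the polygons over the open marked points. -/
def OpenPt (x : d.Discs) : Prop := x.2 = edge (d.polySize x.1) 0 half

theorem surface_openPts : d.surface.openPts = d.quo '' {x | d.OpenPt x} := rfl

theorem OpenPt.not_onSide {x : d.Discs} (h : d.OpenPt x) : ¬ d.OnSide x := by
  obtain ⟨p, z⟩ := x
  obtain rfl : z = edge (d.polySize p) 0 half := h
  exact not_onSide_boundary p half_pos half_lt_one

theorem surface_arcs :
    d.surface.arcs = Set.range fun s => d.quo '' Set.range (d.sidePt s) := by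
  apply Set.Subset.antisymm
  · rintro _ ⟨_, ⟨p, _, ⟨j, h1, h2, rfl⟩, rfl⟩, rfl⟩
    obtain ⟨s, rfl, rfl⟩ := Side.exists_eq p h1 h2
    exact ⟨s, congrArg _ (Set.range_comp _ _)⟩
  · rintro _ ⟨s, rfl⟩
    exact ⟨_, ⟨s.poly, _, ⟨s.num, s.one_le_num, s.num_le, rfl⟩, rfl⟩,
      congrArg _ (Set.range_comp _ _).symm⟩

variable (d) in
/-- The boundary edge of a polygon. -/
noncomputable def boundaryPt (p : d.PolyIdx) (t : I) : d.Discs := ⟨p, edge (d.polySize p) 0 t⟩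

theorem surface_boundary :
    d.surface.boundary = Set.range fun p => d.quo ∘ d.boundaryPt p := by
  apply Set.Subset.antisymm
  · rintro _ ⟨_, ⟨p, _, rfl, rfl⟩, rfl⟩
    exact ⟨p, rfl⟩
  · rintro _ ⟨p, rfl⟩
    exact ⟨_, ⟨p, _, rfl, rfl⟩, rfl⟩

/-- Another quotient of the polygons by the same equivalence relation is homotopic to the marked
surface. -/
theorem homotopic_of_isQuotientMap (T : MarkedSurface) (r : d.Discs → T.carrier)
    (hr : Topology.IsQuotientMap r) (hker : ∀ x y, r x = r y ↔ d.quo x = d.quo y)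
    (hc : r '' {x | d.Vertex x} = T.closedPts) (ho : r '' {x | d.OpenPt x} = T.openPts)
    (ha : (Set.range fun s => r '' Set.range (d.sidePt s)) = T.arcs)
    (hb : (Set.range fun p => r ∘ d.boundaryPt p) = T.boundary) : d.surface.Homotopic T := by
  let f := d.isQuotientMap_quo.lift (f := ⟨d.quo, d.isQuotientMap_quo.continuous⟩)
    ⟨r, hr.continuous⟩ fun x y h => (hker x y).2 h
  let g := hr.lift (f := ⟨r, hr.continuous⟩) ⟨d.quo, d.isQuotientMap_quo.continuous⟩
    fun x y h => (hker x y).1 h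
  have hf : ∀ x, f (d.quo x) = r x := fun x =>
    DFunLike.congr_fun (d.isQuotientMap_quo.lift_comp (f := ⟨d.quo, d.isQuotientMap_quo.continuous⟩)
      ⟨r, hr.continuous⟩ fun x y h => (hker x y).2 h) x
  have hg : ∀ x, g (r x) = d.quo x := fun x =>
    DFunLike.congr_fun (hr.lift_comp (f := ⟨r, hr.continuous⟩)
      ⟨d.quo, d.isQuotientMap_quo.continuous⟩ fun x y h => (hker x y).1 h) x
  let F : d.surface.carrier ≃ₜ T.carrier :=
    { toFun := f
      invFun := g
      left_inv := fun z => by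
        obtain ⟨x, rfl⟩ := d.isQuotientMap_quo.surjective z
        rw [hf, hg]
      right_inv := fun z => by
        obtain ⟨x, rfl⟩ := hr.surjective z
        rw [hg, hf]
      continuous_toFun := f.continuous
      continuous_invFun := g.continuous }
  have hF : F ∘ d.quo = r := funext hf
  have hG : F.symm ∘ r = d.quo := funext hg
  refine ⟨F, ?_, ?_, ?_, ?_, ?_⟩
  · rw [surface_closedPts, ← Set.image_comp, hF, hc]
  · rw [surface_openPts, ← Set.image_comp, hF, ho]
  · rw [surface_arcs, ← Set.range_comp, ← ha]
    congr 1
    funext s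
    change F '' (d.quo '' _) = _
    rw [← Set.image_comp, hF]
  · rw [surface_boundary, ← hb]
    rintro _ ⟨p, rfl⟩
    refine ⟨OrderIso.refl I, p, ?_⟩
    change r ∘ _ = F ∘ d.quo ∘ _
    rw [← Function.comp_assoc, hF]
    rfl
  · rw [surface_boundary, ← hb]
    rintro _ ⟨p, rfl⟩
    refine ⟨OrderIso.refl I, p, ?_⟩
    change d.quo ∘ _ = F.symm ∘ r ∘ _
    rw [← Function.comp_assoc, hG]
    rfl

end GentleDatum

/-! ### Homotopy is an equivalence relation -/

namespace MarkedSurface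

theorem Homotopic.symm {S T : MarkedSurface} (h : S.Homotopic T) : T.Homotopic S := by
  obtain ⟨f, h1, h2, h3, h4, h5⟩ := h
  refine ⟨f.symm, ?_, ?_, ?_, h5, h4⟩
  · rw [← h1, ← Set.image_comp]
    simp
  · rw [← h2, ← Set.image_comp]
    simp
  · rw [← h3, ← Set.image_comp]
    simp [← Set.image_comp]

theorem Homotopic.trans {S T U : MarkedSurface} (h : S.Homotopic T) (h' : T.Homotopic U) :
    S.Homotopic U := by
  obtain ⟨f, h1, h2, h3, h4, h5⟩ := h
  obtain ⟨g, h1', h2', h3', h4', h5'⟩ := h'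
  refine ⟨f.trans g, ?_, ?_, ?_, fun γ hγ => ?_, fun γ hγ => ?_⟩
  · rw [← h1', ← h1, ← Set.image_comp]
    rfl
  · rw [← h2', ← h2, ← Set.image_comp]
    rfl
  · rw [← h3', ← h3, ← Set.image_comp]
    congr 1
    funext c
    exact Set.image_comp g f c
  · obtain ⟨θ, hθ⟩ := h4 γ hγ
    obtain ⟨θ', hθ'⟩ := h4' _ hθ
    exact ⟨θ'.trans θ, hθ'⟩
  · obtain ⟨θ, hθ⟩ := h5' γ hγ
    obtain ⟨θ', hθ'⟩ := h5 _ hθ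
    exact ⟨θ'.trans θ, hθ'⟩

end MarkedSurface

namespace GentleDatum

open MarkedSurface

/-! ### Surfaces glued in the same way -/

/-- A bijection of the polygons and of their sides that respects the sizes, the numbers of the
sides and the gluing makes the marked surfaces homotopic. -/
theorem homotopic_of_equiv {d d' : GentleDatum} (ι : d.PolyIdx ≃ d'.PolyIdx) (κ : d.Side ≃ d'.Side)
    (hsize : ∀ p, d'.polySize (ι p) = d.polySize p) (hpoly : ∀ s, (κ s).poly = ι s.poly)
    (hnum : ∀ s, (κ s).num = s.num) (hopp : ∀ s, κ (d.opp s) = d'.opp (κ s)) :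
    d.surface.Homotopic d'.surface := by
  let h : d.Discs ≃ₜ d'.Discs :=
    { toFun := fun x => ⟨ι x.1, x.2⟩
      invFun := fun x => ⟨ι.symm x.1, x.2⟩
      left_inv := fun x => by simp
      right_inv := fun x => by simp
      continuous_toFun := continuous_sigma fun p =>
        @continuous_sigmaMk d'.PolyIdx (fun _ => Disc) _ (ι p)
      continuous_invFun := continuous_sigma fun p =>
        @continuous_sigmaMk d.PolyIdx (fun _ => Disc) _ (ι.symm p) }
  have hside : ∀ s t, h (d.sidePt s t) = d'.sidePt (κ s) t := by
    intro s t
    simp only [sidePt, hpoly, hnum, hsize]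
    rfl
  have hbd : ∀ p t, h (d.boundaryPt p t) = d'.boundaryPt (ι p) t := by
    intro p t
    simp only [boundaryPt, hsize]
    rfl
  have hclosed : ∀ x, d'.Vertex (h x) ↔ d.Vertex x := by
    intro x
    change x.2 ∈ vertices (d'.polySize (ι x.1)) ↔ _
    rw [hsize]
    rfl
  have hopen : ∀ x, d'.OpenPt (h x) ↔ d.OpenPt x := by
    intro x
    change x.2 = edge (d'.polySize (ι x.1)) 0 half ↔ _
    rw [hsize]
    rfl
  refine homotopic_of_isQuotientMap _ (d'.quo ∘ h) (d'.isQuotientMap_quo.comp h.isQuotientMap)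
    (fun x y => ⟨fun hxy => ?_, fun hxy => ?_⟩) ?_ ?_ ?_ ?_
  · have := apply_eq_of_quo_eq (d.quo ∘ h.symm) (fun s t => ?_) hxy
    · simpa using this
    · obtain ⟨s, rfl⟩ := κ.surjective s
      simp only [Function.comp_apply, ← hopp, ← hside, h.symm_apply_apply]
      exact (quo_sidePt_opp s t).symm
  · refine apply_eq_of_quo_eq (d'.quo ∘ h) (fun s t => ?_) hxy
    simp only [Function.comp_apply, hside, hopp]
    exact (quo_sidePt_opp _ t).symm
  · rw [Set.image_comp, surface_closedPts]
    congr 1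
    ext x
    obtain ⟨x, rfl⟩ := h.surjective x
    rw [h.injective.mem_set_image]
    exact (hclosed x).symm
  · rw [Set.image_comp, surface_openPts]
    congr 1
    ext x
    obtain ⟨x, rfl⟩ := h.surjective x
    rw [h.injective.mem_set_image]
    exact (hopen x).symm
  · rw [surface_arcs, ← κ.surjective.range_comp]
    congr 1
    funext s
    rw [Function.comp_apply, Set.image_comp, ← Set.range_comp]
    congr 2
    exact funext fun t => hside s t
  · rw [surface_boundary, ← ι.surjective.range_comp]
    congr 1
    funext p
    funext t
    exact congrArg d'.quo (hbd p t)

/-- Permuting the blocks does not change the marked surface. -/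
theorem reindex_homotopic (d : GentleDatum) {s' : ℕ} (e : Fin s' ≃ Fin d.s) :
    (d.reindex e).surface.Homotopic d.surface := by
  let f : (d.reindex e).O ≃ d.O := Equiv.sigmaCongrLeft (β := fun i => Fin (d.m i)) e
  have hf : ∀ a b, (d.reindex e).rel a b ↔ d.rel (f a) (f b) := fun _ _ => Iff.rfl
  have hglued : ∀ a, ¬ (d.reindex e).Glued a ↔ ¬ d.Glued (f a) := by
    intro a
    refine not_congr ⟨fun ⟨b, h⟩ => ⟨f b, h⟩, fun ⟨b, h⟩ => ⟨f.symm b, ?_⟩⟩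
    rw [hf, f.apply_symm_apply]
    exact h
  let g : {a : (d.reindex e).O // ¬ (d.reindex e).Glued a} ≃ {a : d.O // ¬ d.Glued a} :=
    f.subtypeEquiv hglued
  refine homotopic_of_equiv (e.sumCongr g) (f.sumCongr g) ?_ ?_ ?_ ?_
  · rintro (i | a) <;> rfl
  · rintro (i | a) <;> rfl
  · rintro (i | a) <;> rfl
  · rintro (a | a)
    · by_cases h : (d.reindex e).Glued a
      · obtain ⟨b, h⟩ := h
        rw [opp_inl_of_rel h]
        exact (opp_inl_of_rel ((hf a b).1 h)).symm
      · rw [opp_inl_of_not_glued h]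
        exact (opp_inl_of_not_glued ((hglued a).1 h)).symm
    · rfl

/-! ### The surface of the Burban–Drozd algebra -/

variable (d : GentleDatum)

theorem not_glued_double (i : Fin d.s) (a : (d.double i).O) : ¬ (d.double i).Glued a :=
  fun ⟨_, h⟩ => h

/-- The polygons from which `BD(S)` is made, among those of the surfaces of all `BD(H_i)`. -/
def toDouble : d.bd.PolyIdx → Σ i : Fin d.s, (d.double i).PolyIdx
  | .inl i => ⟨i, .inl (0 : Fin 1)⟩
  | .inr a => ⟨a.1.1, .inr ⟨⟨(0 : Fin 1), a.1.2⟩, d.not_glued_double _ _⟩⟩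

theorem polySize_toDouble (p : d.bd.PolyIdx) :
    (d.double (d.toDouble p).1).polySize (d.toDouble p).2 = d.bd.polySize p := by
  rcases p with i | a <;> rfl

/-- The points of the polygons of `BD(H_i)` that are not removed. -/
def keptDiscs (i : Fin d.s) : Set (d.double i).Discs :=
  {x | ∀ (j : Fin (d.m i)) h, d.Glued ⟨i, j⟩ → x.1 ≠ Sum.inr ⟨d.pos ⟨i, j⟩, h⟩}

variable {d} in
theorem bd_glued_oddPos {a : d.O} : d.bd.Glued (d.oddPos a) ↔ d.Glued a := by
  constructor
  · rintro ⟨_, a', b, h, h', rfl⟩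
    rw [d.oddPos_injective h']
    exact ⟨b, h⟩
  · rintro ⟨b, h⟩
    exact ⟨_, a, b, h, rfl, rfl⟩

theorem mk_toDouble_mem (p : d.bd.PolyIdx) (z : Disc) :
    (⟨(d.toDouble p).2, z⟩ : (d.double _).Discs) ∈ d.keptDiscs (d.toDouble p).1 := by
  rcases p with i | ⟨⟨i, u⟩, ha⟩
  · intro j h _
    exact Sum.inl_ne_inr
  · intro j h hj heq
    refine ha ?_
    have h1 := congrArg Subtype.val (Sum.inr_injective heq)
    have h2 : u = (d.pos ⟨i, j⟩).2 := eq_of_heq (Sigma.mk.inj h1).2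
    rw [h2]
    exact bd_glued_oddPos.2 hj

theorem exists_toDouble_eq (i : Fin d.s) (p : (d.double i).PolyIdx) (z : Disc)
    (h : (⟨p, z⟩ : (d.double i).Discs) ∈ d.keptDiscs i) : ∃ q, d.toDouble q = ⟨i, p⟩ := by
  rcases p with i' | ⟨⟨i', u⟩, ha⟩
  · obtain rfl : i' = (0 : Fin 1) := Subsingleton.elim (α := Fin 1) _ _
    exact ⟨.inl i, rfl⟩
  · obtain rfl : i' = (0 : Fin 1) := Subsingleton.elim (α := Fin 1) _ _
    refine ⟨.inr ⟨⟨i, u⟩, ?_⟩, rfl⟩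
    rintro ⟨_, a', b, hab, h', rfl⟩
    obtain ⟨i', j⟩ := a'
    obtain rfl : i = i' := congrArg Sigma.fst h'
    obtain rfl : u = _ := eq_of_heq (Sigma.mk.inj h').2
    exact h j ha ⟨b, hab⟩ rfl

/-- The map from the polygons of `BD(S)` to the disjoint union of the incomplete surfaces. -/
def toKept (x : d.bd.Discs) : Σ i, d.kept i :=
  ⟨(d.toDouble x.1).1, ⟨(d.double _).quo ⟨(d.toDouble x.1).2, x.2⟩,
    Set.mem_image_of_mem _ (d.mk_toDouble_mem x.1 x.2)⟩⟩

theorem toKept_surjective : Function.Surjective d.toKept := by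
  rintro ⟨i, _, ⟨p, z⟩, h, rfl⟩
  obtain ⟨q, hq⟩ := d.exists_toDouble_eq i p z h
  refine ⟨⟨q, z⟩, ?_⟩
  have hi := congrArg Sigma.fst hq
  obtain rfl : _ = i := hi
  obtain rfl : _ = p := eq_of_heq (Sigma.mk.inj hq).2
  rfl

theorem isQuotientMap_toKept : Topology.IsQuotientMap d.toKept := by
  have hcont : Continuous d.toKept := by
    refine continuous_sigma fun p => (@continuous_sigmaMk _ (fun i => d.kept i) _ _).comp
      (Continuous.subtype_mk ((d.double (d.toDouble p).1).isQuotientMap_quo.continuous.comp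
        (@continuous_sigmaMk _ (fun _ => Disc) _ (d.toDouble p).2)) _)
  refine IsClosedMap.isQuotientMap (fun C hC => ?_) hcont d.toKept_surjective
  have h1 : d.toKept '' C = ⋃ p : d.bd.PolyIdx, Sigma.mk (β := fun i => d.kept i) (d.toDouble p).1 ''
      (Subtype.val ⁻¹' ((d.double _).quo '' (Sigma.mk (β := fun _ => Disc) (d.toDouble p).2 ''
        (Sigma.mk (β := fun _ => Disc) p ⁻¹' C)))) := by
    ext y
    rw [Set.mem_iUnion]
    constructor
    · rintro ⟨⟨p, z⟩, hx, rfl⟩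
      exact ⟨p, _, ⟨_, ⟨z, hx, rfl⟩, rfl⟩, rfl⟩
    · rintro ⟨p, ⟨w, hw⟩, ⟨_, ⟨z, hz, rfl⟩, rfl⟩, rfl⟩
      exact ⟨⟨p, z⟩, hz, rfl⟩
  rw [h1]
  refine isClosed_iUnion_of_finite fun p => isClosedMap_sigmaMk _ (IsClosed.preimage
    continuous_subtype_val (isClosedMap_quo _ (isClosedMap_sigmaMk _ (hC.preimage
      continuous_sigmaMk))))

/-- The projection from the polygons to `BD(S)`. -/
def toBD (x : d.bd.Discs) : d.BDSurface.carrier := Quot.mk d.BDGlue (d.toKept x)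

theorem isQuotientMap_toBD : Topology.IsQuotientMap d.toBD :=
  (isQuotientMap_quot_mk (r := d.BDGlue)).comp d.isQuotientMap_toKept

open Classical in
/-- The map from the polygons of `BD(H_i)` to the surface of `d.bd` that sends the sides of the
removed `2`-gons to the sides of the large polygon to which they are glued. The values at the other
points of the removed `2`-gons do not matter. -/
noncomputable def retract (i : Fin d.s) : (d.double i).Discs → d.bd.surface.carrier
  | ⟨.inl _, z⟩ => d.bd.quo ⟨.inl i, z⟩
  | ⟨.inr a, z⟩ => if h : d.bd.Glued ⟨i, a.1.2⟩ then
      if h' : ∃ t, z = edge 1 1 t then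
        d.bd.quo (d.bd.sidePt (.inl ⟨i, a.1.2⟩) (unitInterval.symm h'.choose))
      else d.bd.quo ⟨.inl i, z⟩
    else d.bd.quo ⟨.inr ⟨⟨i, a.1.2⟩, h⟩, z⟩

theorem retract_toDouble (p : d.bd.PolyIdx) (z : Disc) :
    d.retract (d.toDouble p).1 ⟨(d.toDouble p).2, z⟩ = d.bd.quo ⟨p, z⟩ := by
  rcases p with i | ⟨a, ha⟩
  · rfl
  · exact dif_neg ha

theorem retract_inr (i : Fin d.s) (a : {a : (d.double i).O // ¬ (d.double i).Glued a}) (t : I) :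
    d.retract i ((d.double i).sidePt (.inr a) t) =
      d.retract i ((d.double i).sidePt ((d.double i).opp (.inr a)) (unitInterval.symm t)) := by
  have h2 : d.retract i ((d.double i).sidePt ((d.double i).opp (.inr a)) (unitInterval.symm t)) =
    d.bd.quo (d.bd.sidePt (.inl ⟨i, a.1.2⟩) (unitInterval.symm t)) := rfl
  rw [h2]
  change d.retract i ⟨.inr a, edge 1 1 t⟩ = _
  rw [retract]
  split_ifs with h h'
  · rw [← edge_injective le_rfl 1 h'.choose_spec]
  · exact (h' ⟨t, rfl⟩).elim
  · have := quo_sidePt_opp (d := d.bd) (.inr ⟨⟨i, a.1.2⟩, h⟩) t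
    rw [opp_inr] at this
    exact this.symm

/-- `retract` takes the same values on glued points, so that it factors through the surface of
`BD(H_i)`. -/
theorem retract_sidePt (i : Fin d.s) (s : (d.double i).Side) (t : I) :
    d.retract i ((d.double i).sidePt s t) =
      d.retract i ((d.double i).sidePt ((d.double i).opp s) (unitInterval.symm t)) := by
  rcases s with a | a
  · have := d.retract_inr i ⟨a, d.not_glued_double i a⟩ (unitInterval.symm t)
    rw [opp_inr, unitInterval.symm_symm] at this
    rw [opp_inl_of_not_glued (d.not_glued_double i a), this]
  · exact d.retract_inr i a t

/-- The remaining `2`-gons are glued already in the incomplete surfaces. -/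
theorem toKept_sidePt_inr (a : {a : d.bd.O // ¬ d.bd.Glued a}) (t : I) :
    d.toKept (d.bd.sidePt (.inr a) t) =
      d.toKept (d.bd.sidePt (.inl a.1) (unitInterval.symm t)) := by
  obtain ⟨⟨i, u⟩, ha⟩ := a
  refine Sigma.ext rfl (heq_of_eq (Subtype.ext ?_))
  exact (quo_sidePt_opp (d := d.double i)
    (.inr ⟨⟨(0 : Fin 1), u⟩, d.not_glued_double i _⟩) t).symm

/-- `BD(S)` and the surface of `d.bd` identify the same points of the polygons. -/
theorem toBD_eq_iff (x y : d.bd.Discs) : d.toBD x = d.toBD y ↔ d.bd.quo x = d.bd.quo y := by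
  constructor
  · intro h
    have hlift : ∀ i (x y : (d.double i).Discs), (d.double i).Glue x y →
        d.retract i x = d.retract i y := by
      intro i x y h
      obtain ⟨s, t, rfl, rfl⟩ := exists_of_glue h
      exact d.retract_sidePt i s t
    let g : (disjointUnion d.incomplete).carrier → d.bd.surface.carrier :=
      fun w => Quot.lift (d.retract w.1) (hlift w.1) w.2.1
    have hg : ∀ x y, d.BDGlue x y → g x = g y := by
      rintro _ _ ⟨a, b, hab, t⟩
      have h1 : d.bd.opp (.inl (d.oddPos a)) = .inl (d.oddPos b) :=
        opp_inl_of_rel ⟨a, b, hab, rfl, rfl⟩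
      have h2 := quo_sidePt_opp (d := d.bd) (.inl (d.oddPos a)) t
      rw [h1] at h2
      exact h2.symm
    have h3 : g (d.toKept x) = g (d.toKept y) := congrArg (Quot.lift g hg) h
    have h4 : ∀ x, g (d.toKept x) = d.bd.quo x := fun x => d.retract_toDouble x.1 x.2
    rwa [h4, h4] at h3
  · refine apply_eq_of_quo_eq d.toBD fun s t => ?_
    have hinr : ∀ (a : {a : d.bd.O // ¬ d.bd.Glued a}) (t : I), d.toBD (d.bd.sidePt (.inr a) t) =
        d.toBD (d.bd.sidePt (d.bd.opp (.inr a)) (unitInterval.symm t)) := fun a t =>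
      congrArg (Quot.mk d.BDGlue) (d.toKept_sidePt_inr a t)
    rcases s with a | a
    · by_cases ha : d.bd.Glued a
      · obtain ⟨b, hab⟩ := ha
        rw [opp_inl_of_rel hab]
        obtain ⟨a, b, hab, rfl, rfl⟩ := hab
        exact Quot.sound (BDGlue.mk a b hab t)
      · have := hinr ⟨a, ha⟩ (unitInterval.symm t)
        rw [opp_inr, unitInterval.symm_symm] at this
        rw [opp_inl_of_not_glued ha, this]
    · exact hinr a t

theorem image_range_sidePt_inr {d : GentleDatum} {Z : Type*} (f : d.Discs → Z)
    (a : {a : d.O // ¬ d.Glued a})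
    (h : ∀ t, f (d.sidePt (.inr a) t) = f (d.sidePt (.inl a.1) (unitInterval.symm t))) :
    f '' Set.range (d.sidePt (.inr a)) = f '' Set.range (d.sidePt (.inl a.1)) := by
  rw [← Set.range_comp, ← Set.range_comp, ← unitInterval.symm_bijective.surjective.range_comp]
  congr 1
  funext t
  have := h (unitInterval.symm t)
  rw [unitInterval.symm_symm] at this
  exact this

theorem toKept_preimage_closedPts (x : d.bd.Discs) :
    (d.toKept x).2.1 ∈ (d.double (d.toKept x).1).surface.closedPts ↔ d.bd.Vertex x := by
  have h1 : (d.double _).Vertex ⟨(d.toDouble x.1).2, x.2⟩ ↔ d.bd.Vertex x := by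
    rw [Vertex, polySize_toDouble]
    rfl
  rw [← h1, surface_closedPts]
  constructor
  · rintro ⟨y, hy, h⟩
    exact vertex_of_quo_eq h hy
  · intro h
    exact ⟨_, h, rfl⟩

theorem toKept_preimage_openPts (x : d.bd.Discs) :
    (d.toKept x).2.1 ∈ (d.double (d.toKept x).1).surface.openPts ↔ d.bd.OpenPt x := by
  have h1 : (d.double _).OpenPt ⟨(d.toDouble x.1).2, x.2⟩ ↔ d.bd.OpenPt x := by
    rw [OpenPt, polySize_toDouble]
    rfl
  rw [← h1, surface_openPts]
  constructor
  · rintro ⟨y, hy, h⟩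
    rwa [← eq_of_quo_eq (OpenPt.not_onSide hy) h]
  · intro h
    exact ⟨_, h, rfl⟩

theorem toKept_arcs : (Set.range fun s => d.toKept '' Set.range (d.bd.sidePt s)) =
    (disjointUnion d.incomplete).arcs := by
  have hinl : ∀ (i : Fin d.s) (u : Fin (d.bd.m i)),
      d.toKept '' Set.range (d.bd.sidePt (.inl ⟨i, u⟩)) =
        Sigma.mk (β := fun i => d.kept i) i '' (Subtype.val ⁻¹' ((d.double i).quo ''
          Set.range ((d.double i).sidePt (.inl ⟨(0 : Fin 1), u⟩)))) := by
    intro i u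
    ext w
    constructor
    · rintro ⟨_, ⟨t, rfl⟩, rfl⟩
      exact ⟨_, ⟨_, ⟨t, rfl⟩, rfl⟩, rfl⟩
    · rintro ⟨⟨_, hw⟩, ⟨_, ⟨t, rfl⟩, rfl⟩, rfl⟩
      exact ⟨_, ⟨t, rfl⟩, rfl⟩
  apply Set.Subset.antisymm
  · have key : ∀ (i : Fin d.s) (u : Fin (d.bd.m i)),
        d.toKept '' Set.range (d.bd.sidePt (.inl ⟨i, u⟩)) ∈ (disjointUnion d.incomplete).arcs := by
      intro i u
      refine ⟨i, _, ?_, hinl i u⟩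
      change Subtype.val '' _ ∈ (d.double i).surface.arcs
      rw [surface_arcs, Subtype.image_preimage_coe, Set.inter_eq_right.2]
      · exact ⟨_, rfl⟩
      · rintro _ ⟨_, ⟨t, rfl⟩, rfl⟩
        exact ⟨_, fun _ _ _ => Sum.inl_ne_inr, rfl⟩
    rintro _ ⟨⟨i, u⟩ | a, rfl⟩
    · exact key i u
    · dsimp only
      rw [image_range_sidePt_inr d.toKept a (d.toKept_sidePt_inr a)]
      exact key _ _
  · rintro _ ⟨i, c, hc, rfl⟩
    have hc : Subtype.val '' c ∈ (d.double i).surface.arcs := hc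
    rw [surface_arcs] at hc
    obtain ⟨u, hu⟩ : ∃ u : Fin (d.bd.m i), (d.double i).quo ''
        Set.range ((d.double i).sidePt (.inl ⟨(0 : Fin 1), u⟩)) = Subtype.val '' c := by
      obtain ⟨s, hs⟩ := hc
      have hfin : ∀ a : (d.double i).O, a = ⟨(0 : Fin 1), a.2⟩ := fun a =>
        Sigma.ext (Subsingleton.elim (α := Fin 1) _ _) HEq.rfl
      rcases s with a | a
      · exact ⟨a.2, by rw [← hs, ← hfin a]⟩
      · refine ⟨a.1.2, ?_⟩
        rw [← hs, ← hfin a.1]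
        exact (image_range_sidePt_inr (d.double i).quo a fun t =>
          (quo_sidePt_opp (.inr a) t).symm).symm
    refine ⟨.inl ⟨i, u⟩, ?_⟩
    refine (hinl i u).trans (congrArg _ ?_)
    rw [hu]
    exact Set.preimage_image_eq _ Subtype.val_injective

theorem toKept_boundary : (Set.range fun p => d.toKept ∘ d.bd.boundaryPt p) =
    (disjointUnion d.incomplete).boundary := by
  have hb : ∀ (p : d.bd.PolyIdx) (t : I), (d.toKept (d.bd.boundaryPt p t)).2.1 =
      (d.double _).quo ((d.double _).boundaryPt (d.toDouble p).2 t) := by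
    intro p t
    change _ = (d.double _).quo ⟨_, edge ((d.double _).polySize _) 0 t⟩
    rw [polySize_toDouble]
    rfl
  apply Set.Subset.antisymm
  · rintro _ ⟨p, rfl⟩
    refine ⟨(d.toDouble p).1, fun t => (d.toKept (d.bd.boundaryPt p t)).2, ?_, rfl⟩
    change Subtype.val ∘ _ ∈ (d.double _).surface.boundary
    rw [surface_boundary]
    exact ⟨(d.toDouble p).2, funext fun t => (hb p t).symm⟩
  · rintro _ ⟨i, γ, hγ, rfl⟩
    have hγ : Subtype.val ∘ γ ∈ (d.double i).surface.boundary := hγ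
    rw [surface_boundary] at hγ
    obtain ⟨p, hp⟩ := hγ
    -- The removed `2`-gons are excluded by their open marked points.
    obtain ⟨y, hy, hy'⟩ : (@id (d.kept i) (γ half)).1 ∈ d.kept i :=
      (@id (d.kept i) (γ half)).2
    have h1 : (d.double i).quo ((d.double i).boundaryPt p half) = (d.double i).quo y :=
      (congrFun hp half).trans hy'.symm
    have h2 := eq_of_quo_eq (not_onSide_boundary p half_pos half_lt_one) h1
    have hy : y ∈ d.keptDiscs i := hy
    rw [← h2] at hy
    obtain ⟨q, hq⟩ := d.exists_toDouble_eq i p _ hy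
    obtain rfl : _ = i := congrArg Sigma.fst hq
    obtain rfl : _ = p := eq_of_heq (Sigma.mk.inj hq).2
    refine ⟨q, funext fun t => Sigma.ext rfl (heq_of_eq (Subtype.ext ?_))⟩
    exact (hb q t).trans (congrFun hp t)

/-- `BD(S)` is homotopic to the marked surface of the presentation `d.bd`. -/
theorem bd_homotopic : d.bd.surface.Homotopic d.BDSurface := by
  have himage : ∀ {X Y Z : Type} (q : Y → Z) (f : X → Y) (_ : Function.Surjective f) (A : Set X)
      (B : Set Y) (_ : ∀ x, f x ∈ B ↔ x ∈ A), (q ∘ f) '' A = q '' B := by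
    intro X Y Z q f hf A B h
    have : A = f ⁻¹' B := Set.ext fun x => (h x).symm
    rw [Set.image_comp, this, Set.image_preimage_eq _ hf]
  have hrange : ∀ {X Y Z J : Type} (q : Y → Z) (f : X → Y) (A : J → Set X),
      (Set.range fun s => (q ∘ f) '' A s) =
        (fun c => q '' c) '' Set.range fun s => f '' A s := by
    intro X Y Z J q f A
    rw [← Set.range_comp]
    simp only [Function.comp_def, Set.image_image]
  refine homotopic_of_isQuotientMap _ d.toBD d.isQuotientMap_toBD d.toBD_eq_iff ?_ ?_ ?_ ?_
  · exact himage (Quot.mk d.BDGlue) d.toKept d.toKept_surjective _ _ d.toKept_preimage_closedPts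
  · exact himage (Quot.mk d.BDGlue) d.toKept d.toKept_surjective _ _ d.toKept_preimage_openPts
  · exact (hrange (Quot.mk d.BDGlue) d.toKept _).trans (congrArg _ d.toKept_arcs)
  · exact (Set.range_comp (fun γ => Quot.mk d.BDGlue ∘ γ) _).trans (congrArg _ d.toKept_boundary)

end GentleDatum

namespace MarkedSurface

open Filter Topology

/-! ### Lifting maps through a quotient map with finite fibres -/

/-- A continuous map `h` into a quotient of `X'` lifts to `X'` if the quotient map is closed with
finite fibres, the fibres over the image of a dense set `V` are single points, and every point of
`X` has small neighbourhoods that meet `V` in a connected set. The lift on `V` extends continuously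
since its cluster set at a point is connected and lies in a finite fibre. -/
theorem exists_continuous_lift {X X' S' : Type*} [TopologicalSpace X] [TopologicalSpace X']
    [TopologicalSpace S'] [T2Space X'] [RegularSpace X'] {q : X' → S'} (hq : IsClosedMap q)
    (hsurj : Function.Surjective q) (hfin : ∀ s, (q ⁻¹' {s}).Finite) {h : X → S'}
    (hh : Continuous h) {V : Set X} (hV : Dense V)
    (hconn : ∀ x, ∀ N ∈ 𝓝 x, ∃ U ∈ 𝓝 x, U ⊆ N ∧ IsPreconnected (U ∩ V))
    (hsing : ∀ x ∈ V, (q ⁻¹' {h x}).Subsingleton) :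
    ∃ G : X → X', Continuous G ∧ ∀ x, q (G x) = h x := by
  choose g hg using fun x => hsurj (h x)
  have key : ∀ x (p : X' → Prop), (∀ y, q y = h x → ∀ᶠ z in 𝓝 y, p z) →
      ∀ᶠ x' in 𝓝 x, p (g x') := fun x p hp =>
    ((hh.tendsto x).eventually (hq.eventually_nhds_fiber (h x) hp)).mono
      fun x' hx' => hx' (g x') (hg x')
  have hcont : ContinuousOn g V := by
    intro x hx
    refine (Tendsto.mono_left ?_ nhdsWithin_le_nhds : Tendsto g (𝓝[V] x) _)
    intro W hW
    refine key x (· ∈ W) fun y hy => ?_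
    rw [hsing x hx hy (hg x)]
    exact hW
  have hlim : ∀ x, ∃ y, q y = h x ∧ Tendsto g (𝓝[V] x) (𝓝 y) := by
    intro x
    obtain ⟨W, hW, hdisj⟩ := (hfin (h x)).t2_separation
    obtain ⟨U, hU, hUN, hUc⟩ := hconn x _ (key x (fun z => ∃ y, q y = h x ∧ z ∈ W y)
      fun y hy => Filter.mem_of_superset ((hW y).2.mem_nhds (hW y).1) fun z hz => ⟨y, hy, hz⟩)
    obtain ⟨x0, hx0⟩ := mem_closure_iff_nhds.1 (hV x) U hU
    obtain ⟨y0, hy0, hxy0⟩ := hUN hx0.1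
    have hsub : g '' (U ∩ V) ⊆ W y0 := by
      refine IsPreconnected.subset_left_of_subset_union (hW y0).2
        (v := ⋃ y ∈ {y | q y = h x ∧ y ≠ y0}, W y) (isOpen_biUnion fun y _ => (hW y).2) ?_ ?_
        ⟨g x0, ⟨x0, hx0, rfl⟩, hxy0⟩ (hUc.image g (hcont.mono Set.inter_subset_right))
      · rw [Set.disjoint_iUnion₂_right]
        exact fun y hy => hdisj hy0 hy.1 hy.2.symm
      · rintro _ ⟨z, hz, rfl⟩
        obtain ⟨y, hy, hzy⟩ := hUN hz.1
        by_cases h0 : y = y0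
        · exact Or.inl (h0 ▸ hzy)
        · exact Or.inr (Set.mem_iUnion₂.2 ⟨y, ⟨hy, h0⟩, hzy⟩)
    refine ⟨y0, hy0, fun O hO => ?_⟩
    change ∀ᶠ z in 𝓝[V] x, g z ∈ O
    have h1 := key x (fun z => z ∈ O ∨ ∃ y, q y = h x ∧ y ≠ y0 ∧ z ∈ W y) (fun y hy => by
      by_cases h0 : y = y0
      · subst h0
        exact Filter.mem_of_superset hO fun z hz => Or.inl hz
      · exact Filter.mem_of_superset ((hW y).2.mem_nhds (hW y).1) fun z hz => Or.inr ⟨y, hy, h0, hz⟩)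
    filter_upwards [mem_nhdsWithin_of_mem_nhds h1, mem_nhdsWithin_of_mem_nhds hU,
      self_mem_nhdsWithin] with z hz hzU hzV
    rcases hz with hz | ⟨y, hy, hne, hz⟩
    · exact hz
    · exact (Set.disjoint_left.1 (hdisj hy0 hy hne.symm) (hsub ⟨z, ⟨hzU, hzV⟩, rfl⟩) hz).elim
  refine ⟨extendFrom V g, continuous_extendFrom hV fun x => (hlim x).imp fun y hy => hy.2,
    fun x => ?_⟩
  obtain ⟨y, hy, hxy⟩ := hlim x
  rw [extendFrom_eq (hV x) hxy, hy]

/-! ### Homeomorphisms of polygons -/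

/-- The union of the closed arcs of the `(m + 1)`-gon. -/
def sides (m : ℕ) : Set Disc := {z | ∃ j t, 1 ≤ j ∧ j ≤ m ∧ z = edge m j t}

theorem sides_eq {m : ℕ} (hm : 1 ≤ m) : sides m = circ m '' Set.Icc 1 (m + 1) := by
  apply Set.Subset.antisymm
  · rintro _ ⟨j, t, h1, h2, rfl⟩
    have h1' : (1 : ℝ) ≤ j := by exact_mod_cast h1
    have h2' : (j : ℝ) ≤ m := by exact_mod_cast h2
    have h3 := t.2.1
    have h4 := t.2.2
    exact ⟨j + t, ⟨by linarith, by linarith⟩, rfl⟩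
  · rintro _ ⟨x, ⟨h1, h2⟩, rfl⟩
    rcases h2.lt_or_eq with h2 | rfl
    · have h3 : (⌊x⌋₊ : ℝ) ≤ x := Nat.floor_le (by linarith)
      have h4 := Nat.lt_floor_add_one x
      refine ⟨⌊x⌋₊, ⟨x - ⌊x⌋₊, by linarith, by linarith⟩, Nat.le_floor (by exact_mod_cast h1),
        Nat.lt_succ_iff.1 ((Nat.floor_lt (by linarith)).2 (by push_cast; exact h2)), ?_⟩
      rw [edge_eq_circ]
      simp
    · exact ⟨m, 1, hm, le_rfl, by simp [edge_eq_circ]⟩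

theorem circ_injOn {m : ℕ} : Set.InjOn (circ m) (Set.Icc 1 (m + 1)) := by
  intro x hx y hy h
  exact eq_of_circ_eq h (by linarith [hx.2, hy.1]) (by linarith [hy.2, hx.1])

theorem circ_mem_vertices {m : ℕ} {x : ℝ} (hx : x ∈ Set.Icc (1 : ℝ) (m + 1)) :
    circ m x ∈ vertices m ↔ ∃ n : ℕ, x = n := by
  constructor
  · rintro ⟨j, -, h⟩
    rw [edge_eq_circ] at h
    obtain ⟨n, hn⟩ := circ_eq_circ.1 h
    have h1 : x = ((j + n * (m + 1) : ℤ) : ℝ) := by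
      push_cast
      rw [hn]
      simp
    have h2 : (0 : ℤ) ≤ j + n * (m + 1) := by
      have : (0 : ℝ) ≤ ((j + n * (m + 1) : ℤ) : ℝ) := by rw [← h1]; linarith [hx.1]
      exact_mod_cast this
    refine ⟨(j + n * (m + 1) : ℤ).toNat, ?_⟩
    rw [h1]
    exact_mod_cast (Int.toNat_of_nonneg h2).symm
  · rintro ⟨n, rfl⟩
    have h2 : n ≤ m + 1 := by exact_mod_cast hx.2
    rcases h2.lt_or_eq with h2 | rfl
    · exact ⟨n, by omega, by simp [edge_eq_circ]⟩
    · refine ⟨0, by omega, ?_⟩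
      rw [← edge_last]
      simp [edge_eq_circ]

/-- A continuous injection of polygons that preserves the sides, the vertices and the end of the
boundary edge moves along the sides monotonically, and does not move vertices backwards. -/
theorem exists_strictMonoOn {m m' : ℕ} (hm : 1 ≤ m) (hm' : 1 ≤ m') {γ : Disc → Disc}
    (hγ : Continuous γ) (hinj : Function.Injective γ) (hs : ∀ z ∈ sides m, γ z ∈ sides m')
    (hv : ∀ z ∈ vertices m, γ z ∈ vertices m') (h1 : γ (circ m 1) = circ m' 1) :
    ∃ f : ℝ → ℝ, StrictMonoOn f (Set.Icc 1 (m + 1)) ∧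
      Set.MapsTo f (Set.Icc 1 (m + 1)) (Set.Icc 1 (m' + 1)) ∧
      (∀ x ∈ Set.Icc (1 : ℝ) (m + 1), γ (circ m x) = circ m' (f x)) ∧
      ∀ n : ℕ, 1 ≤ n → n ≤ m + 1 → ∃ n' : ℕ, n ≤ n' ∧ f n = n' := by
  have hex : ∀ x : Set.Icc (1 : ℝ) (m + 1), ∃ y : Set.Icc (1 : ℝ) (m' + 1),
      circ m' y = γ (circ m x) := by
    intro x
    have h := hs (circ m x) (by rw [sides_eq hm]; exact ⟨x, x.2, rfl⟩)
    rw [sides_eq hm'] at h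
    obtain ⟨y, hy, h⟩ := h
    exact ⟨⟨y, hy⟩, h⟩
  choose ψ hψ using hex
  have hemb : IsClosedEmbedding fun y : Set.Icc (1 : ℝ) (m' + 1) => circ m' y := by
    refine Continuous.isClosedEmbedding ((continuous_circ m').comp continuous_subtype_val) ?_
    intro x y h
    exact Subtype.ext (circ_injOn x.2 y.2 h)
  have hψc : Continuous ψ := by
    rw [hemb.isInducing.continuous_iff]
    have : (fun y : Set.Icc (1 : ℝ) (m' + 1) => circ m' y) ∘ ψ =
        fun x : Set.Icc (1 : ℝ) (m + 1) => γ (circ m x) := funext hψ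
    rw [this]
    exact hγ.comp ((continuous_circ m).comp continuous_subtype_val)
  have hle : (1 : ℝ) ≤ m + 1 := by linarith [(Nat.cast_nonneg m : (0 : ℝ) ≤ m)]
  let f : ℝ → ℝ := fun x => ψ (Set.projIcc 1 (m + 1 : ℝ) hle x)
  have hf : ∀ x ∈ Set.Icc (1 : ℝ) (m + 1), γ (circ m x) = circ m' (f x) := by
    intro x hx
    have := hψ (Set.projIcc 1 (m + 1 : ℝ) hle x)
    rw [Set.projIcc_of_mem hle hx] at this
    change _ = circ m' (ψ (Set.projIcc 1 (m + 1 : ℝ) hle x))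
    rw [Set.projIcc_of_mem hle hx, this]
  have hmaps : Set.MapsTo f (Set.Icc 1 (m + 1)) (Set.Icc 1 (m' + 1)) := fun x _ => (ψ _).2
  have hfc : Continuous f := continuous_subtype_val.comp (hψc.comp continuous_projIcc)
  have hfi : Set.InjOn f (Set.Icc 1 (m + 1)) := by
    intro x hx y hy h
    refine circ_injOn hx hy (hinj ?_)
    rw [hf x hx, hf y hy, h]
  have hf1 : f 1 = 1 := by
    have h2 : (1 : ℝ) ∈ Set.Icc (1 : ℝ) (m + 1) := ⟨le_rfl, hle⟩
    refine circ_injOn (hmaps h2) ⟨le_rfl, by linarith [(Nat.cast_nonneg m' : (0 : ℝ) ≤ m')]⟩ ?_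
    rw [← hf 1 h2, h1]
  have hmono : StrictMonoOn f (Set.Icc 1 (m + 1)) := by
    rcases hfc.continuousOn.strictMonoOn_of_injOn_Icc' hle hfi with h | h
    · exact h
    · exfalso
      have hm1 : (1 : ℝ) < m + 1 := by
        have : (1 : ℝ) ≤ m := by exact_mod_cast hm
        linarith
      have h2 := h ⟨le_rfl, hle⟩ ⟨hle, le_rfl⟩ hm1
      rw [hf1] at h2
      exact absurd (hmaps ⟨hle, le_rfl⟩).1 (not_le.2 h2)
  refine ⟨f, hmono, hmaps, hf, ?_⟩
  have hmem : ∀ n : ℕ, 1 ≤ n → n ≤ m + 1 → (n : ℝ) ∈ Set.Icc (1 : ℝ) (m + 1) :=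
    fun n h1 h2 => ⟨by exact_mod_cast h1, by exact_mod_cast h2⟩
  intro n hn
  induction n, hn using Nat.le_induction with
  | base => exact fun _ => ⟨1, le_rfl, by simpa using hf1⟩
  | succ n hn ih =>
    intro hn'
    obtain ⟨n', h2, h3⟩ := ih (by omega)
    have h4 := hmem (n + 1) (by omega) hn'
    have h5 := hv _ ((circ_mem_vertices h4).2 ⟨n + 1, rfl⟩)
    rw [hf _ h4, circ_mem_vertices (hmaps h4)] at h5
    obtain ⟨n'', h5⟩ := h5
    refine ⟨n'', ?_, h5⟩
    have h6 := hmono (hmem n hn (by omega)) h4 (by push_cast; linarith)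
    rw [h3, h5] at h6
    have : n' < n'' := by exact_mod_cast h6
    omega

/-- A homeomorphism of polygons that preserves the sides, the vertices and the end of the boundary
edge preserves the numbers of the edges. -/
theorem eq_and_exists_edge_eq {m m' : ℕ} (hm : 1 ≤ m) (hm' : 1 ≤ m') {γ γ' : Disc → Disc}
    (hγ : Continuous γ) (hγ' : Continuous γ') (h : Function.LeftInverse γ' γ)
    (h' : Function.LeftInverse γ γ') (hs : ∀ z, γ z ∈ sides m' ↔ z ∈ sides m)
    (hv : ∀ z, γ z ∈ vertices m' ↔ z ∈ vertices m) (h1 : γ (circ m 1) = circ m' 1) :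
    m' = m ∧ ∀ j, 1 ≤ j → j ≤ m → ∀ t : I, 0 < t → t < 1 →
      ∃ t' : I, 0 < t' ∧ t' < 1 ∧ γ (edge m j t) = edge m' j t' := by
  obtain ⟨f, hf1, hf2, hf3, hf4⟩ := exists_strictMonoOn hm hm' hγ h.injective
    (fun z hz => (hs z).2 hz) (fun z hz => (hv z).2 hz) h1
  obtain ⟨g, hg1, hg2, hg3, hg4⟩ := exists_strictMonoOn hm' hm hγ' h'.injective
    (fun z hz => (hs _).1 (by rwa [h'])) (fun z hz => (hv _).1 (by rwa [h']))
    (by rw [← h1, h])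
  have hmem : ∀ (m n : ℕ), 1 ≤ n → n ≤ m + 1 → (n : ℝ) ∈ Set.Icc (1 : ℝ) (m + 1) :=
    fun m n h1 h2 => ⟨by exact_mod_cast h1, by exact_mod_cast h2⟩
  have hle : ∀ (m n : ℕ), (n : ℝ) ∈ Set.Icc (1 : ℝ) (m + 1) → 1 ≤ n ∧ n ≤ m + 1 :=
    fun m n h => ⟨by exact_mod_cast h.1, by exact_mod_cast h.2⟩
  have hfn : ∀ n : ℕ, 1 ≤ n → n ≤ m + 1 → f n = n := by
    intro n hn1 hn2
    obtain ⟨n', h2, h3⟩ := hf4 n hn1 hn2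
    have h4 := hf2 (hmem m n hn1 hn2)
    have h6 := hf3 _ (hmem m n hn1 hn2)
    rw [h3] at h4 h6
    obtain ⟨h5, h5'⟩ := hle m' n' h4
    obtain ⟨n'', h7, h8⟩ := hg4 n' h5 h5'
    have h9 := hg3 _ h4
    have h10 := hg2 h4
    rw [h8] at h9 h10
    rw [← h6, h] at h9
    have h11 : (n : ℝ) = n'' := circ_injOn (hmem m n hn1 hn2) h10 h9
    have h12 : n = n'' := by exact_mod_cast h11
    rw [h3]
    exact_mod_cast (by omega : n' = n)
  have hmm : m ≤ m' := by
    have h2 := hf2 (hmem m (m + 1) (by omega) le_rfl)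
    rw [hfn _ (by omega) le_rfl] at h2
    have := (hle _ _ h2).2
    omega
  have hmm' : m' ≤ m := by
    obtain ⟨n, h2, h3⟩ := hg4 (m' + 1) (by omega) le_rfl
    have h4 := hg2 (hmem m' (m' + 1) (by omega) le_rfl)
    rw [h3] at h4
    have := (hle _ _ h4).2
    omega
  refine ⟨by omega, fun j hj1 hj2 t h0 ht => ?_⟩
  have h0 : (0 : ℝ) < t := h0
  have ht : (t : ℝ) < 1 := ht
  have hj := hmem m j hj1 (by omega)
  have hj' := hmem m (j + 1) (by omega) (by omega)
  push_cast at hj'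
  have hx : (j + t : ℝ) ∈ Set.Icc (1 : ℝ) (m + 1) :=
    ⟨by linarith [hj.1], by linarith [hj'.2]⟩
  have h2 := hf1 hj hx (by linarith)
  have h3 := hf1 hx hj' (by linarith)
  rw [hfn j hj1 (by omega)] at h2
  have h4 := hfn (j + 1) (by omega) (by omega)
  push_cast at h4
  rw [h4] at h3
  refine ⟨⟨f (j + t) - j, by linarith, by linarith⟩, ?_, ?_, ?_⟩
  · rw [← Subtype.coe_lt_coe]
    change (0 : ℝ) < f (j + t) - j
    linarith
  · rw [← Subtype.coe_lt_coe]
    change f (j + t) - j < (1 : ℝ)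
    linarith
  · rw [edge_eq_circ, hf3 _ hx, edge_eq_circ]
    simp

theorem norm_eq_one_of_mem_sides {m : ℕ} {z : Disc} (h : z ∈ sides m) : ‖(z : ℂ)‖ = 1 := by
  obtain ⟨j, t, -, -, rfl⟩ := h
  exact Circle.norm_coe _

theorem dense_compl_sides (m : ℕ) : Dense (sides m)ᶜ := by
  intro z
  have h0 : {w : Disc | ‖(w : ℂ)‖ < 1} ⊆ (sides m)ᶜ := fun w hw h =>
    (ne_of_lt hw) (norm_eq_one_of_mem_sides h)
  refine closure_mono h0 ?_
  rw [closure_subtype]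
  have h1 : Subtype.val '' {w : Disc | ‖(w : ℂ)‖ < 1} = Metric.ball (0 : ℂ) 1 := by
    ext w
    rw [mem_ball_zero_iff]
    constructor
    · rintro ⟨w, hw, rfl⟩
      exact hw
    · intro hw
      exact ⟨⟨w, mem_closedBall_zero_iff.2 hw.le⟩, hw, rfl⟩
  rw [h1, closure_ball _ one_ne_zero]
  exact z.2

/-- The disc is strictly convex, so that removing a part of its boundary circle leaves a convex
set. -/
theorem isPreconnected_ball_diff_sides (m : ℕ) (z : Disc) (r : ℝ) :
    IsPreconnected (Metric.ball z r ∩ (sides m)ᶜ) := by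
  rw [← IsInducing.subtypeVal.isPreconnected_image]
  refine Convex.isPreconnected ?_
  rw [convex_iff_pairwise_pos]
  rintro _ ⟨a, ⟨ha, ha'⟩, rfl⟩ _ ⟨b, ⟨hb, hb'⟩, rfl⟩ hab s t hs ht hst
  have h1 := strictConvex_closedBall ℝ (0 : ℂ) 1 a.2 b.2 hab hs ht hst
  have h2 : s • (a : ℂ) + t • (b : ℂ) ∈ Metric.ball (0 : ℂ) 1 := by
    rwa [interior_closedBall _ one_ne_zero] at h1
  refine ⟨⟨_, Metric.ball_subset_closedBall h2⟩, ⟨?_, fun h => ?_⟩, rfl⟩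
  · exact convex_ball (z : ℂ) r ha hb hs.le ht.le hst
  · exact (ne_of_lt (mem_ball_zero_iff.1 h2)) (norm_eq_one_of_mem_sides h)

end MarkedSurface

namespace GentleDatum

open MarkedSurface Topology

variable {d d' : GentleDatum}

/-! ### Lifting homeomorphisms of surfaces to the polygons -/

theorem onSide_iff_mem_sides (p : d.PolyIdx) (z : Disc) :
    d.OnSide ⟨p, z⟩ ↔ z ∈ sides (d.polySize p) := by
  constructor
  · rintro ⟨s, t, h⟩
    obtain rfl : p = s.poly := congrArg Sigma.fst h
    exact ⟨s.num, t, s.one_le_num, s.num_le, eq_of_heq (Sigma.mk.inj h).2⟩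
  · rintro ⟨j, t, h1, h2, rfl⟩
    obtain ⟨s, rfl, rfl⟩ := Side.exists_eq p h1 h2
    exact ⟨s, t, rfl⟩

theorem dense_not_onSide : Dense {x | ¬ d.OnSide x} := by
  rintro ⟨p, z⟩
  have h1 : Set.MapsTo (Sigma.mk (β := fun _ => Disc) p) (sides (d.polySize p))ᶜ
      {x | ¬ d.OnSide x} := fun w hw h => hw ((onSide_iff_mem_sides p w).1 h)
  exact map_mem_closure continuous_sigmaMk (dense_compl_sides (d.polySize p) z) h1

theorem exists_nhds_isPreconnected (x : d.Discs) {N : Set d.Discs} (hN : N ∈ 𝓝 x) :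
    ∃ U ∈ 𝓝 x, U ⊆ N ∧ IsPreconnected (U ∩ {x | ¬ d.OnSide x}) := by
  obtain ⟨p, z⟩ := x
  have h1 : Sigma.mk (β := fun _ => Disc) p ⁻¹' N ∈ 𝓝 z :=
    (@continuous_sigmaMk _ (fun _ => Disc) _ p).continuousAt hN
  obtain ⟨r, hr, hrN⟩ := Metric.mem_nhds_iff.1 h1
  refine ⟨Sigma.mk p '' Metric.ball z r,
    isOpenMap_sigmaMk.image_mem_nhds (Metric.ball_mem_nhds z hr), Set.image_subset_iff.2 hrN, ?_⟩
  have h2 : Sigma.mk (β := fun _ => Disc) p '' Metric.ball z r ∩ {x | ¬ d.OnSide x} =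
      Sigma.mk (β := fun _ => Disc) p '' (Metric.ball z r ∩ (sides (d.polySize p))ᶜ) := by
    ext x
    constructor
    · rintro ⟨⟨w, hw, rfl⟩, h⟩
      exact ⟨w, ⟨hw, fun h' => h ((onSide_iff_mem_sides p w).2 h')⟩, rfl⟩
    · rintro ⟨w, ⟨hw, h⟩, rfl⟩
      exact ⟨⟨w, hw, rfl⟩, fun h' => h ((onSide_iff_mem_sides p w).1 h')⟩
  rw [h2]
  exact (isPreconnected_ball_diff_sides _ z r).image _ continuous_sigmaMk.continuousOn

theorem sUnion_arcs : ⋃₀ d.surface.arcs = d.quo '' {x | d.OnSide x} := by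
  rw [surface_arcs]
  ext z
  constructor
  · rintro ⟨_, ⟨s, rfl⟩, _, ⟨t, rfl⟩, rfl⟩
    exact ⟨_, ⟨s, t, rfl⟩, rfl⟩
  · rintro ⟨_, ⟨s, t, rfl⟩, rfl⟩
    exact ⟨_, ⟨s, rfl⟩, _, ⟨t, rfl⟩, rfl⟩

theorem onSide_of_image_arcs (f : d.surface.carrier ≃ₜ d'.surface.carrier)
    (ha : (fun c : Set d.surface.carrier => f '' c) '' d.surface.arcs = d'.surface.arcs)
    {x : d.Discs} {y : d'.Discs} (h : d'.quo y = f (d.quo x)) : d'.OnSide y ↔ d.OnSide x := by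
  have h1 : d'.quo '' {y | d'.OnSide y} = f '' (d.quo '' {x | d.OnSide x}) := by
    rw [← sUnion_arcs, ← sUnion_arcs, ← ha, Set.image_sUnion]
  constructor
  · intro hy
    obtain ⟨_, ⟨x', hx', rfl⟩, hxy⟩ := h1.subset ⟨y, hy, rfl⟩
    exact onSide_of_quo_eq (f.injective (hxy.trans h)) hx'
  · intro hx
    obtain ⟨y', hy', hxy⟩ := h1.superset ⟨_, ⟨x, hx, rfl⟩, rfl⟩
    exact onSide_of_quo_eq (hxy.trans h.symm) hy'

theorem vertex_of_image_closedPts (f : d.surface.carrier ≃ₜ d'.surface.carrier)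
    (hc : f '' d.surface.closedPts = d'.surface.closedPts)
    {x : d.Discs} {y : d'.Discs} (h : d'.quo y = f (d.quo x)) : d'.Vertex y ↔ d.Vertex x := by
  rw [surface_closedPts, surface_closedPts] at hc
  constructor
  · intro hy
    obtain ⟨_, ⟨x', hx', rfl⟩, hxy⟩ := hc.superset ⟨y, hy, rfl⟩
    exact vertex_of_quo_eq (f.injective (hxy.trans h)) hx'
  · intro hx
    obtain ⟨y', hy', hxy⟩ := hc.subset ⟨_, ⟨x, hx, rfl⟩, rfl⟩
    exact vertex_of_quo_eq (hxy.trans h.symm) hy'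

/-- A homeomorphism of surfaces that preserves the union of the arcs lifts to the polygons. -/
theorem exists_lift (f : d.surface.carrier ≃ₜ d'.surface.carrier)
    (ha : ∀ x y, d'.quo y = f (d.quo x) → (d'.OnSide y ↔ d.OnSide x)) :
    ∃ G : d.Discs → d'.Discs, Continuous G ∧ ∀ x, d'.quo (G x) = f (d.quo x) := by
  refine exists_continuous_lift isClosedMap_quo d'.isQuotientMap_quo.surjective finite_quo_fiber
    (f.continuous.comp d.isQuotientMap_quo.continuous) dense_not_onSide
    (fun x N hN => exists_nhds_isPreconnected x hN) fun x hx y hy y' hy' => ?_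
  exact eq_of_quo_eq (fun h => hx ((ha x y hy).1 h)) (Eq.trans hy (Eq.symm hy'))

theorem leftInverse_of_lift (f : d.surface.carrier ≃ₜ d'.surface.carrier) {G : d.Discs → d'.Discs}
    {G' : d'.Discs → d.Discs} (hG : Continuous G) (hG' : Continuous G')
    (h : ∀ x, d'.quo (G x) = f (d.quo x)) (h' : ∀ y, d.quo (G' y) = f.symm (d'.quo y)) :
    Function.LeftInverse G' G := by
  refine congrFun (Continuous.ext_on dense_not_onSide (hG'.comp hG) continuous_id fun x hx => ?_)
  refine (eq_of_quo_eq hx ?_).symm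
  rw [h', h, f.symm_apply_apply]

/-- The lift maps polygons to polygons and the sides of a polygon to the sides with the same
numbers. -/
theorem exists_polygon_map (f : d.surface.carrier ≃ₜ d'.surface.carrier)
    (hc : f '' d.surface.closedPts = d'.surface.closedPts)
    (ha : (fun c : Set d.surface.carrier => f '' c) '' d.surface.arcs = d'.surface.arcs)
    (hb : ∀ γ ∈ d.surface.boundary, ∃ θ : I ≃o I, f ∘ γ ∘ θ ∈ d'.surface.boundary) :
    ∃ ι : d.PolyIdx ≃ d'.PolyIdx, (∀ p, d'.polySize (ι p) = d.polySize p) ∧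
      ∀ (s : d.Side) (s' : d'.Side), s'.poly = ι s.poly → s'.num = s.num →
        ∃ t : I, 0 < t ∧ t < 1 ∧ d'.quo (d'.sidePt s' t) = f (d.quo (d.sidePt s half)) := by
  have hside : ∀ x y, d'.quo y = f (d.quo x) → (d'.OnSide y ↔ d.OnSide x) :=
    fun x y h => onSide_of_image_arcs f ha h
  obtain ⟨G, hG, hGf⟩ := exists_lift f hside
  obtain ⟨G', hG', hGf'⟩ := exists_lift f.symm fun y x h =>
    (hside x y (by rw [h, f.apply_symm_apply])).symm
  have hl := leftInverse_of_lift f hG hG' hGf hGf'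
  have hr : Function.LeftInverse G G' := leftInverse_of_lift f.symm hG' hG hGf' hGf
  have hex : ∀ p, ∃ q, ∃ γ : Disc → Disc, Continuous γ ∧ ∀ z, G ⟨p, z⟩ = ⟨q, γ z⟩ := by
    intro p
    have : ConnectedSpace Disc := isConnected_iff_connectedSpace.1
      ((convex_closedBall (0 : ℂ) 1).isConnected ⟨0, by simp⟩)
    obtain ⟨q, γ, hγ, h⟩ := (hG.comp (@continuous_sigmaMk _ (fun _ => Disc) _ p)).exists_lift_sigma
    exact ⟨q, γ, hγ, congrFun h⟩
  have hex' : ∀ p, ∃ q, ∃ γ : Disc → Disc, Continuous γ ∧ ∀ z, G' ⟨p, z⟩ = ⟨q, γ z⟩ := by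
    intro p
    have : ConnectedSpace Disc := isConnected_iff_connectedSpace.1
      ((convex_closedBall (0 : ℂ) 1).isConnected ⟨0, by simp⟩)
    obtain ⟨q, γ, hγ, h⟩ := (hG'.comp (@continuous_sigmaMk _ (fun _ => Disc) _ p)).exists_lift_sigma
    exact ⟨q, γ, hγ, congrFun h⟩
  choose ι γ hγ hι using hex
  choose ι' γ' hγ' hι' using hex'
  let o : Disc := ⟨0, by simp⟩
  have hιι : Function.LeftInverse ι' ι := fun p => by
    have := hl ⟨p, o⟩
    rw [hι, hι'] at this
    exact congrArg Sigma.fst this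
  have hιι' : Function.LeftInverse ι ι' := fun p => by
    have := hr ⟨p, o⟩
    rw [hι', hι] at this
    exact congrArg Sigma.fst this
  have hpoly : ∀ p, d'.polySize (ι p) = d.polySize p ∧
      ∀ j, 1 ≤ j → j ≤ d.polySize p → ∀ t : I, 0 < t → t < 1 →
        ∃ t' : I, 0 < t' ∧ t' < 1 ∧ γ p (edge (d.polySize p) j t) =
          edge (d'.polySize (ι p)) j t' := by
    intro p
    have hp : ∀ z, d'.quo ⟨ι p, γ p z⟩ = f (d.quo ⟨p, z⟩) := fun z => by rw [← hι, hGf]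
    refine eq_and_exists_edge_eq (one_le_polySize p) (one_le_polySize _) (hγ p) (hγ' (ι p))
      (fun z => ?_) (fun z => ?_) (fun z => ?_)
      (fun z => vertex_of_image_closedPts f hc (hp z)) ?_
    · have h1 := hl ⟨p, z⟩
      rw [hι, hι'] at h1
      exact eq_of_heq (Sigma.mk.inj h1).2
    · have h1 := hr ⟨ι p, z⟩
      rw [hι', hιι, hι] at h1
      exact eq_of_heq (Sigma.mk.inj h1).2
    · rw [← onSide_iff_mem_sides, ← onSide_iff_mem_sides]
      exact hside _ _ (hp z)
    · -- The boundary edges determine the orientation of the polygons.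
      rw [surface_boundary] at hb
      obtain ⟨θ, hθ⟩ := hb _ ⟨p, rfl⟩
      rw [surface_boundary] at hθ
      obtain ⟨q, hq⟩ := hθ
      have h1 : ∀ t ∈ Set.Ioo (0 : I) 1, d'.boundaryPt q t = G (d.boundaryPt p (θ t)) := by
        intro t ht
        refine eq_of_quo_eq (not_onSide_boundary q ht.1 ht.2) ?_
        rw [hGf]
        exact congrFun hq t
      have hdense : Dense (Set.Ioo (0 : I) 1) := by
        intro t
        rw [closure_Ioo (by simp)]
        exact ⟨unitInterval.nonneg', unitInterval.le_one'⟩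
      have hbc : ∀ (d : GentleDatum) (p : d.PolyIdx), Continuous (d.boundaryPt p) := fun d p =>
        continuous_sigmaMk.comp (continuous_edge _ 0)
      have h2 := congrFun (Continuous.ext_on hdense (hbc d' q)
        (hG.comp ((hbc d p).comp θ.continuous)) h1) 1
      have h3 : θ 1 = 1 := θ.map_top
      simp only [Function.comp_apply, h3] at h2
      have h4 : G (d.boundaryPt p 1) = ⟨ι p, γ p (edge (d.polySize p) 0 1)⟩ := hι p _
      rw [h4] at h2
      obtain rfl : q = ι p := congrArg Sigma.fst h2
      have h5 : edge (d'.polySize (ι p)) 0 1 = γ p (edge (d.polySize p) 0 1) :=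
        eq_of_heq (Sigma.mk.inj h2).2
      have h6 : ∀ m, circ m 1 = edge m 0 1 := fun m => by simp [edge_eq_circ]
      rw [h6, h6, h5]
  refine ⟨⟨ι, ι', hιι, hιι'⟩, fun p => (hpoly p).1, fun s s' h1 h2 => ?_⟩
  obtain ⟨t, h0, ht, h⟩ := (hpoly s.poly).2 s.num s.one_le_num s.num_le half half_pos half_lt_one
  refine ⟨t, h0, ht, ?_⟩
  rw [← hGf, sidePt, sidePt, hι, h, h2, h1]
  rfl

/-- The marked surface determines the presentation up to a permutation of the blocks. -/
theorem eq_reindex_of_homotopic (h : d.surface.Homotopic d'.surface) :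
    ∃ e : Fin d.s ≃ Fin d'.s, d = d'.reindex e := by
  obtain ⟨f, hc, -, ha, hb, -⟩ := h
  obtain ⟨ι, hsize, hside⟩ := exists_polygon_map f hc ha hb
  -- The polygons of the blocks are those with at least two arcs.
  have hinl : ∀ {d : GentleDatum} (p : d.PolyIdx), 2 ≤ d.polySize p → ∃ i, p = .inl i := by
    rintro d (i | a) h
    · exact ⟨i, rfl⟩
    · exact absurd h (by simp [polySize])
  have hι : ∀ i, ∃ i', ι (.inl i) = .inl i' := fun i =>
    hinl _ (by rw [hsize]; exact d.two_le i)
  have hι' : ∀ i, ∃ i', ι.symm (.inl i) = .inl i' := fun i =>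
    hinl _ (by rw [← hsize, ι.apply_symm_apply]; exact d'.two_le i)
  choose e he using hι
  choose e' he' using hι'
  let E : Fin d.s ≃ Fin d'.s :=
    { toFun := e
      invFun := e'
      left_inv := fun i => by
        have := he' (e i)
        rw [← he, ι.symm_apply_apply] at this
        exact (Sum.inl_injective this).symm
      right_inv := fun i => by
        have := he (e' i)
        rw [← he', ι.apply_symm_apply] at this
        exact (Sum.inl_injective this).symm }
  have hm : ∀ i, d.m i = d'.m (E i) := fun i => by
    have := hsize (.inl i)
    rw [he] at this
    exact this.symm
  have hκ : ∀ s : d.Side, ∃ s' : d'.Side, s'.poly = ι s.poly ∧ s'.num = s.num := fun s =>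
    Side.exists_eq _ s.one_le_num (by rw [hsize]; exact s.num_le)
  choose κ hκ1 hκ2 using hκ
  have hκinj : Function.Injective κ := fun s s' h => by
    refine Side.ext (ι.injective ?_) ?_
    · rw [← hκ1, ← hκ1, h]
    · rw [← hκ2, ← hκ2, h]
  have hopp : ∀ s, κ (d.opp s) = d'.opp (κ s) := by
    intro s
    obtain ⟨t, h0, h1, h⟩ := hside s (κ s) (hκ1 s) (hκ2 s)
    obtain ⟨t', h0', h1', h'⟩ := hside (d.opp s) (κ (d.opp s)) (hκ1 _) (hκ2 _)
    have h2 := quo_sidePt_opp s half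
    rw [symm_half] at h2
    rw [h2, ← h] at h'
    rcases quo_eq h'.symm with h3 | ⟨h3, -⟩ | ⟨s0, t0, -, -, h3, h4⟩
    · exact (opp_ne s (hκinj (eq_of_sidePt_eq h0 h1 h3).1).symm).elim
    · rcases vertex_sidePt.1 h3 with rfl | rfl
      · exact (lt_irrefl _ h0).elim
      · exact (lt_irrefl _ h1).elim
    · rw [(eq_of_sidePt_eq h0 h1 h3).1]
      exact (eq_of_sidePt_eq h0' h1' h4).1
  have hκinl : ∀ a : d.O, κ (.inl a) = .inl ⟨E a.1, Fin.cast (hm _) a.2⟩ := fun a =>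
    Side.ext ((hκ1 _).trans (he a.1)) (hκ2 _)
  refine ⟨E, eq_reindex _ _ E hm fun a b => ?_⟩
  rw [rel_iff_opp, rel_iff_opp, ← hκinl, ← hκinl, ← hopp, hκinj.eq_iff]

end GentleDatum

theorem proposition3p1 {k : Type*} [Field k] (d : GentleDatum) :
    -- (1) the marked surfaces of `BD(A)`
    ((∃ d' : GentleDatum, Nonempty (d'.algebra k ≃ₐ[k] d.BDAlgebra k)) ∧
      ∀ d' : GentleDatum, Nonempty (d'.algebra k ≃ₐ[k] d.BDAlgebra k) →
        d'.surface.Homotopic d.BDSurface) ∧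
    -- (2) the gentle algebras of `BD(S)`
    ((∃ d' : GentleDatum, d'.surface.Homotopic d.BDSurface) ∧
      ∀ d' : GentleDatum, d'.surface.Homotopic d.BDSurface →
        Nonempty (d'.algebra k ≃ₐ[k] d.BDAlgebra k)) := by
  obtain ⟨φ⟩ := d.nonempty_bd_algEquiv k
  refine ⟨⟨⟨d.bd, ⟨φ⟩⟩, ?_⟩, ⟨d.bd, d.bd_homotopic⟩, ?_⟩
  · rintro d' ⟨ψ⟩
    obtain ⟨e, he⟩ := GentleDatum.eq_reindex_of_algEquiv (ψ.trans φ.symm)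
    rw [he]
    exact (d.bd.reindex_homotopic e).trans d.bd_homotopic
  · intro d' h
    obtain ⟨e, he⟩ := GentleDatum.eq_reindex_of_homotopic (h.trans d.bd_homotopic.symm)
    rw [he]
    obtain ⟨ψ⟩ := d.bd.nonempty_reindex_algEquiv k e
    exact ⟨ψ.trans φ⟩
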